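/- Let $n\ge 1$. Let $s_i(z)=\sum_{1\le k_1<\dots<k_i\le n}z_{k_1}\cdots z_{k_i}$ ($1\le i\le n$) be the elementary symmetric polynomials in $z\in\mathbb C^n$, let $\mathbf s=(s_1,\dots,s_n):\mathbb C^n\to\mathbb C^n$, and let $\Gamma_n=\mathbf s(\overline{\mathbb D}^n)$ be the image of the closed unit polydisc ($\Gamma_0$ is the one-point set $\mathbb C^0$). Let $b\Gamma_n$ be the distinguished boundary of $\Gamma_n$, i.e. the Shilov boundary (smallest closed boundary) of the algebra of functions that are continuous on $\Gamma_n$ and analytic on its interior. Operators are bounded linear operators on complex Hilbert spaces. A tuple $(S_1,\dots,S_n)$ of commuting operators on a Hilbert space $\mathcal H$ is called - a $\Gamma_n$-contraction if $\|p(S_1,\dots,S_n)\|\le\sup_{z\in\Gamma_n}|p(z)|$ for every polynomial $p\in\mathbb C[z_1,\dots,z_n]$ (this is used for every length $n\ge 0$); - a $\Gamma_n$-unitary if every $S_i$ is normal and the joint spectrum of $(S_1,\dots,S_n)$ is contained in $b\Gamma_n$; - a $\Gamma_n$-isometry if there are a Hilbert space $\mathcal K\supseteq\mathcal H$ and a $\Gamma_n$-unitary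 $(\widetilde S_1,\dots,\widetilde S_n)$ on $\mathcal K$ such that $\mathcal H$ is invariant under every $\widetilde S_i$ and $S_i=\widetilde S_i|_{\mathcal H}$ for every $i$; - a pure $\Gamma_n$-isometry if it is a $\Gamma_n$-isometry and $S_n$ is a pure isometry, i.e. an isometry with $\bigcap_{k\ge 0}S_n^k\mathcal H=\{0\}$. **Theorem.** Let $S_1,\dots,S_n$ be commuting operators on a Hilbert space $\mathcal H$. The following are equivalent: (i) $(S_1,\dots,S_n)$ is a $\Gamma_n$-isometry. (ii) There is an orthogonal decomposition $\mathcal H=\mathcal H_1\oplus\mathcal H_2$ into closed subspaces (either of which may be zero), each reducing for all of $S_1,\dots,S_n$, such that $(S_1|_{\mathcal H_1},\dots,S_n|_{\mathcal H_1})$ is a $\Gamma_n$-unitary and $(S_1|_{\mathcal H_2},\dots,S_n|_{\mathcal H_2})$ is a pure $\Gamma_n$-isometry. (iii) $S_n^*S_n=I$, $S_n^*S_i=S_{n-i}^*$ for $i=1,\dots,n-1$, and $(\gamma_1S_1,\dots,\gamma_{n-1}S_{n-1})$ is a $\Gamma_{n-1}$-contraction, where $\gamma_i=\frac{n-i}{n}$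 for $i=1,\dots,n-1$. -/

import Mathlib

universe u

namespace SymmetrizedDisc

/-- The symmetrization map `ℂⁿ → ℂⁿ`; with indices counted from `0`, the entry of index `i` is
the elementary symmetric polynomial of degree `i + 1`. -/
noncomputable def symmetrization (n : ℕ) (z : Fin n → ℂ) : Fin n → ℂ :=
  fun i => MvPolynomial.eval z (MvPolynomial.esymm (Fin n) ℂ ((i : ℕ) + 1))

/-- The closed symmetrized `n`-disc `Γ_n`, the image of the closed unit polydisc. -/
def Gamma (n : ℕ) : Set (Fin n → ℂ) :=
  symmetrization n '' {z | ∀ i, ‖z i‖ ≤ 1}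

/-- `f` belongs to the algebra of functions that are continuous on `X` and analytic on the
interior of `X`. -/
def IsAnalyticContinuous {n : ℕ} (X : Set (Fin n → ℂ)) (f : (Fin n → ℂ) → ℂ) : Prop :=
  ContinuousOn f X ∧ AnalyticOnNhd ℂ f (interior X)

/-- `B` is a closed boundary of `X`: a closed subset of `X` on which every function of the algebra
above attains its maximum modulus over `X`. -/
def IsClosedBoundary {n : ℕ} (X B : Set (Fin n → ℂ)) : Prop :=
  IsClosed B ∧ B ⊆ X ∧
    ∀ f, IsAnalyticContinuous X f → ∃ y ∈ B, ∀ x ∈ X, ‖f x‖ ≤ ‖f y‖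

/-- The distinguished boundary `bΓ_n`: the Shilov boundary (smallest closed boundary) of the algebra
of functions continuous on `Γ_n` and analytic on its interior. -/
def distinguishedBoundary (n : ℕ) : Set (Fin n → ℂ) :=
  ⋂₀ {B | IsClosedBoundary (Gamma n) B}

section Operators

variable {H : Type u} [NormedAddCommGroup H] [InnerProductSpace ℂ H]

/-- `p(S_1, …, S_n)`. The monomials are evaluated as ordered products, and the order is immaterial
when the operators commute. -/
noncomputable def polyEval {n : ℕ} (S : Fin n → H →L[ℂ] H) (p : MvPolynomial (Fin n) ℂ) :
    H →L[ℂ] H :=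
  ∑ m ∈ p.support, p.coeff m • (List.ofFn fun i => S i ^ m i).prod

/-- The supremum `‖p‖_{∞,Γ_n}` of `|p|` over the (compact, nonempty) set `Γ_n`. -/
noncomputable def supNormGamma {n : ℕ} (p : MvPolynomial (Fin n) ℂ) : ℝ :=
  sSup ((fun z => ‖MvPolynomial.eval z p‖) '' Gamma n)

/-- `Γ_n`-contractions: commuting tuples having `Γ_n` as a spectral set. -/
def IsGammaContraction {n : ℕ} (S : Fin n → H →L[ℂ] H) : Prop :=
  (∀ i j, Commute (S i) (S j)) ∧
    ∀ p : MvPolynomial (Fin n) ℂ, ‖polyEval S p‖ ≤ supNormGamma p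

/-- The joint (Harte) spectrum: `w` is outside it iff the operators `S_i - w_i` generate
the whole algebra of bounded operators both as a left ideal and as a right ideal. For commuting
normal operators it agrees with the other usual joint spectra (Taylor, bicommutant,
and Gelfand spectrum of the generated unital C*-algebra). -/
def jointSpectrum {n : ℕ} (S : Fin n → H →L[ℂ] H) : Set (Fin n → ℂ) :=
  {w | ¬ ((∃ B : Fin n → H →L[ℂ] H, ∑ i, B i * (S i - w i • 1) = 1) ∧
          (∃ B : Fin n → H →L[ℂ] H, ∑ i, (S i - w i • 1) * B i = 1))}

/-- `Γ_n`-unitaries: commuting normal operators with joint spectrum in `bΓ_n`. -/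
def IsGammaUnitary [CompleteSpace H] {n : ℕ} (S : Fin n → H →L[ℂ] H) : Prop :=
  (∀ i j, Commute (S i) (S j)) ∧ (∀ i, IsStarNormal (S i)) ∧
    jointSpectrum S ⊆ distinguishedBoundary n

/-- `Γ_n`-isometries: restrictions of `Γ_n`-unitaries to a common invariant subspace. The larger
Hilbert space `K` contains `H` through the linear isometric embedding `V`. -/
def IsGammaIsometry {n : ℕ} (S : Fin n → H →L[ℂ] H) : Prop :=
  ∃ (K : Type u) (_ : NormedAddCommGroup K) (_ : InnerProductSpace ℂ K) (_ : CompleteSpace K)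
    (V : H →ₗᵢ[ℂ] K) (T : Fin n → K →L[ℂ] K),
      IsGammaUnitary T ∧ ∀ i x, T i (V x) = V (S i x)

/-- Pure isometries: isometries `T` with `⋂ₖ Tᵏ H = {0}`. -/
def IsPureIsometry (T : H →L[ℂ] H) : Prop :=
  Isometry T ∧ ⋂ k : ℕ, Set.range (T ^ k) = {0}

/-- Pure `Γ_n`-isometries, for `n = m + 1`: `Γ_n`-isometries whose last entry is a pure
isometry. -/
def IsPureGammaIsometry {m : ℕ} (S : Fin (m + 1) → H →L[ℂ] H) : Prop :=
  IsGammaIsometry S ∧ IsPureIsometry (S (Fin.last m))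

/-- The restriction of a tuple to a common invariant subspace. -/
def restrictTuple {n : ℕ} (S : Fin n → H →L[ℂ] H) (M : Submodule ℂ H)
    (hM : ∀ i, ∀ x ∈ M, S i x ∈ M) : Fin n → M →L[ℂ] M :=
  fun i => ((S i).comp M.subtypeL).codRestrict M fun x => hM i x x.2

/-- `M` is invariant under `T` and its adjoint. -/
def IsReducing [CompleteSpace H] (T : H →L[ℂ] H) (M : Submodule ℂ H) : Prop :=
  (∀ x ∈ M, T x ∈ M) ∧ ∀ x ∈ M, ContinuousLinearMap.adjoint T x ∈ M

end Operators

end SymmetrizedDisc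

/-! Condition (iii) is the operator form of a theorem on the location of roots. Read `w` as the
signed coefficients of a monic polynomial `p` of degree `n`. Then `w ∈ Γ_n` says that the roots of
`p` lie in the closed disc, and `w ∈ bΓ_n` that they lie on the unit circle
(`distinguishedBoundary_eq`). The numbers `γᵢ wᵢ` are the coefficients of `p'/n`. All roots are on
the circle exactly when `p` is self-inversive and the roots of `p'` are in the closed disc: one
direction is `conj_symmetrization_last_mul` with Gauss-Lucas (`derivCoeffs_mem_Gamma`), the other is
Cohn's theorem (`mem_image_torus_of_selfInversive`).

For commuting normal operators, Gelfand theory applies these scalar facts at each character: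
`Γ_n`-unitaries satisfy (iii), and a commuting tuple satisfying (iii) with `S_n` surjective is a
`Γ_n`-unitary. Polynomial convexity of `Γ_{n-1}` turns the norm inequalities into membership of
points.

Condition (iii) is inherited by restrictions, whence (i) ⇒ (iii). The unitary extension of the
isometry `S_n` carries along every operator commuting with `S_n` and preserves (iii), whence (iii) ⇒
(i). For (ii), the Wold subspace of `S_n` reduces every `S_i` because `S_i* = S_n* S_{n-i}`, and
`S_n` is surjective on it; conversely (iii) survives orthogonal sums. -/

namespace SymmetrizedDisc

/-! ### Points of `ℂⁿ` as monic polynomials, and `Γ_n` in terms of roots. -/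

open Polynomial

/-- The monic polynomial `Xⁿ - w₁ Xⁿ⁻¹ + w₂ Xⁿ⁻² - ⋯` with signed coefficients `w`. -/
noncomputable def monicOfCoeffs {n : ℕ} (w : Fin n → ℂ) : ℂ[X] :=
  X ^ n + ∑ i : Fin n, C ((-1) ^ ((i : ℕ) + 1) * w i) * X ^ (n - 1 - (i : ℕ))

lemma prod_X_sub_C_eq_monicOfCoeffs {n : ℕ} (z : Fin n → ℂ) :
    ∏ i, (X - C (z i)) = monicOfCoeffs (symmetrization n z) := by
  have h := Multiset.prod_X_sub_X_eq_sum_esymm (Finset.univ.val.map z)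
  rw [Multiset.map_map] at h
  have hc : Multiset.card (Finset.univ.val.map z) = n := by simp
  have h0 : (Finset.univ.val.map z).esymm 0 = 1 := by
    rw [← MvPolynomial.aeval_esymm_eq_multiset_esymm (Fin n) ℂ, MvPolynomial.esymm_zero, map_one]
  rw [hc, Finset.sum_range_succ', h0] at h
  simp only [pow_zero, one_mul, map_one, Nat.sub_zero] at h
  change (Finset.univ.val.map (fun i => X - C (z i))).prod = _ at h
  rw [Finset.prod, h, monicOfCoeffs, add_comm, Finset.sum_range]
  congr 1
  refine Finset.sum_congr rfl fun i _ => ?_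
  have : symmetrization n z i = (Finset.univ.val.map z).esymm ((i : ℕ) + 1) := by
    rw [symmetrization, ← MvPolynomial.aeval_esymm_eq_multiset_esymm (Fin n) ℂ]
    rfl
  rw [this, map_mul, map_pow, map_neg, map_one, mul_assoc]
  congr 3
  omega

lemma coeff_monicOfCoeffs {n : ℕ} (w : Fin n → ℂ) (i : Fin n) :
    (monicOfCoeffs w).coeff (n - 1 - (i : ℕ)) = (-1) ^ ((i : ℕ) + 1) * w i := by
  rw [monicOfCoeffs, coeff_add, finsetSum_coeff, coeff_X_pow, if_neg (by omega), zero_add,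
    Finset.sum_eq_single i]
  · rw [coeff_C_mul, coeff_X_pow, if_pos rfl, mul_one]
  · intro b _ hb
    rw [coeff_C_mul, coeff_X_pow, if_neg (by omega), mul_zero]
  · simp

lemma monicOfCoeffs_injective {n : ℕ} :
    Function.Injective (monicOfCoeffs : (Fin n → ℂ) → ℂ[X]) := by
  intro w w' h
  ext i
  have := coeff_monicOfCoeffs w i
  rw [h, coeff_monicOfCoeffs] at this
  exact (mul_left_cancel₀ (pow_ne_zero _ (by norm_num)) this).symm

lemma degree_sum_monicOfCoeffs_lt {n : ℕ} (w : Fin n → ℂ) :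
    (∑ i : Fin n, C ((-1) ^ ((i : ℕ) + 1) * w i) * X ^ (n - 1 - (i : ℕ))).degree < (n : WithBot ℕ) := by
  refine (degree_sum_le _ _).trans_lt ((Finset.sup_lt_iff (WithBot.bot_lt_coe n)).2 fun i _ => ?_)
  refine (degree_C_mul_X_pow_le _ _).trans_lt ?_
  exact Nat.cast_lt.2 (by omega)

lemma monic_monicOfCoeffs {n : ℕ} (w : Fin n → ℂ) : (monicOfCoeffs w).Monic :=
  monic_X_pow_add (degree_sum_monicOfCoeffs_lt w)

lemma natDegree_monicOfCoeffs {n : ℕ} (w : Fin n → ℂ) : (monicOfCoeffs w).natDegree = n := by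
  rw [monicOfCoeffs, natDegree_eq_of_degree_eq_some]
  rw [degree_add_eq_left_of_degree_lt] <;> rw [degree_X_pow]
  exact degree_sum_monicOfCoeffs_lt w

lemma symmetrization_surjective (n : ℕ) : Function.Surjective (symmetrization n) := by
  intro w
  have hs := IsAlgClosed.splits (monicOfCoeffs w)
  have hcard : Multiset.card (monicOfCoeffs w).roots = n := by
    rw [splits_iff_card_roots.1 hs, natDegree_monicOfCoeffs]
  obtain ⟨l, hl⟩ := Quot.exists_rep (monicOfCoeffs w).roots
  have hlen : l.length = n := by rw [← hcard, ← hl]; rfl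
  subst hlen
  refine ⟨l.get, monicOfCoeffs_injective ?_⟩
  rw [← prod_X_sub_C_eq_monicOfCoeffs]
  have h := C_leadingCoeff_mul_prod_multiset_X_sub_C (splits_iff_card_roots.1 hs)
  rw [(monic_monicOfCoeffs w).leadingCoeff, map_one, one_mul, ← hl] at h
  rw [← h]
  change _ = (l.map _).prod
  rw [← List.prod_ofFn]
  congr 1
  conv_rhs => rw [← List.ofFn_get l, List.map_ofFn]
  rfl

lemma eval_monicOfCoeffs {n : ℕ} (w : Fin n → ℂ) (t : ℂ) :
    (monicOfCoeffs w).eval t =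
      t ^ n + ∑ i : Fin n, (-1) ^ ((i : ℕ) + 1) * w i * t ^ (n - 1 - (i : ℕ)) := by
  simp [monicOfCoeffs, eval_finsetSum]

lemma eval_monicOfCoeffs_symmetrization {n : ℕ} (z : Fin n → ℂ) (t : ℂ) :
    (monicOfCoeffs (symmetrization n z)).eval t = ∏ i, (t - z i) := by
  rw [← prod_X_sub_C_eq_monicOfCoeffs, eval_prod]
  simp

/-- The coordinates of any preimage of `w` are the roots of `monicOfCoeffs w`, so a condition on all
coordinates is a condition on all roots. -/
lemma mem_image_symmetrization_iff {n : ℕ} (w : Fin n → ℂ) (p : ℂ → Prop) :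
    w ∈ symmetrization n '' {z | ∀ i, p (z i)} ↔ ∀ t, (monicOfCoeffs w).eval t = 0 → p t := by
  constructor
  · rintro ⟨z, hz, rfl⟩ t ht
    rw [eval_monicOfCoeffs_symmetrization, Finset.prod_eq_zero_iff] at ht
    obtain ⟨i, -, hi⟩ := ht
    rw [sub_eq_zero.1 hi]
    exact hz i
  · intro h
    obtain ⟨z, rfl⟩ := symmetrization_surjective n w
    refine ⟨z, fun i => h _ ?_, rfl⟩
    rw [eval_monicOfCoeffs_symmetrization]
    exact Finset.prod_eq_zero (Finset.mem_univ i) (sub_self _)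

lemma mem_Gamma_iff {n : ℕ} (w : Fin n → ℂ) :
    w ∈ Gamma n ↔ ∀ t, (monicOfCoeffs w).eval t = 0 → ‖t‖ ≤ 1 :=
  mem_image_symmetrization_iff w fun t => ‖t‖ ≤ 1

/-! ### Critical points, self-inversive polynomials and Cohn's theorem. -/

/-- The coefficients, normalised as in `monicOfCoeffs`, of the derivative divided by the degree. -/
noncomputable def derivCoeffs {m : ℕ} (w : Fin (m + 1) → ℂ) : Fin m → ℂ :=
  fun j => (((m : ℂ) - ((j : ℕ) : ℂ)) / ((m : ℂ) + 1)) * w j.castSucc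

lemma natCast_add_one_ne_zero (m : ℕ) : (m : ℂ) + 1 ≠ 0 := by exact_mod_cast m.succ_ne_zero

lemma derivative_monicOfCoeffs {m : ℕ} (w : Fin (m + 1) → ℂ) :
    derivative (monicOfCoeffs w) = C ((m : ℂ) + 1) * monicOfCoeffs (derivCoeffs w) := by
  have hm := natCast_add_one_ne_zero m
  simp only [monicOfCoeffs, derivative_add, derivative_sum, derivative_C_mul, derivative_X_pow,
    Fin.sum_univ_castSucc, mul_add, Finset.mul_sum]
  simp only [Fin.val_last, Nat.add_sub_cancel, Nat.sub_self, Nat.cast_zero, map_zero, zero_mul,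
    mul_zero, add_zero, Nat.cast_add, Nat.cast_one, Fin.val_castSucc]
  congr 1
  refine Finset.sum_congr rfl fun j _ => ?_
  have hj := j.2
  rw [show m - (j : ℕ) - 1 = m - 1 - (j : ℕ) by omega, ← mul_assoc, ← mul_assoc, ← C_mul, ← C_mul,
    Nat.cast_sub hj.le, derivCoeffs]
  congr 2
  field_simp

/-- Gauss-Lucas: critical points lie in the convex hull of the roots, hence in the disc. -/
lemma derivCoeffs_mem_Gamma {m : ℕ} {w : Fin (m + 1) → ℂ} (hw : w ∈ Gamma (m + 1)) :
    derivCoeffs w ∈ Gamma m := by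
  rw [mem_Gamma_iff] at hw ⊢
  intro t ht
  have hdeg : 0 < (monicOfCoeffs w).degree := by
    rw [← natDegree_pos_iff_degree_pos, natDegree_monicOfCoeffs]; omega
  have hne : derivative (monicOfCoeffs w) ≠ 0 := by
    rw [derivative_monicOfCoeffs]
    exact mul_ne_zero (C_ne_zero.2 (natCast_add_one_ne_zero m)) (monic_monicOfCoeffs _).ne_zero
  have hmem : t ∈ (derivative (monicOfCoeffs w)).rootSet ℂ := by
    rw [mem_rootSet, coe_aeval_eq_eval, derivative_monicOfCoeffs, eval_mul, ht, mul_zero,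
      ← derivative_monicOfCoeffs]
    exact ⟨hne, rfl⟩
  have hsub : (monicOfCoeffs w).rootSet ℂ ⊆ Metric.closedBall 0 1 := fun s hs => by
    rw [mem_rootSet, coe_aeval_eq_eval] at hs
    simpa using hw s hs.2
  simpa using convexHull_min hsub (convex_closedBall _ _)
    (rootSet_derivative_subset_convexHull_rootSet hdeg hmem)

lemma symmetrization_last {m : ℕ} (z : Fin (m + 1) → ℂ) :
    symmetrization (m + 1) z (Fin.last m) = ∏ i, z i := by
  have : Finset.powersetCard (m + 1) (Finset.univ : Finset (Fin (m + 1))) = {Finset.univ} := by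
    simpa using Finset.powersetCard_self (Finset.univ : Finset (Fin (m + 1)))
  simp [symmetrization, MvPolynomial.esymm, this]

lemma symmetrization_apply {n : ℕ} (z : Fin n → ℂ) (j : Fin n) :
    symmetrization n z j =
      ∑ t ∈ Finset.powersetCard ((j : ℕ) + 1) Finset.univ, ∏ i ∈ t, z i := by
  simp [symmetrization, MvPolynomial.esymm]

-- On the torus `conj (z i)` is the inverse of `z i`, so the conjugated full product cancels the
-- factors indexed by a set `t` and leaves the conjugated product over its complement.
open ComplexConjugate in
lemma conj_symmetrization_last_mul {m : ℕ} {z : Fin (m + 1) → ℂ} (hz : ∀ i, ‖z i‖ = 1)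
    (j : Fin m) :
    conj (symmetrization (m + 1) z (Fin.last m)) * symmetrization (m + 1) z j.castSucc =
      conj (symmetrization (m + 1) z j.rev.castSucc) := by
  have hz' : ∀ i, conj (z i) * z i = 1 := fun i => by
    rw [← Complex.normSq_eq_conj_mul_self, Complex.normSq_eq_norm_sq, hz]; simp
  rw [symmetrization_last, symmetrization_apply, symmetrization_apply, Finset.mul_sum, map_sum]
  refine Finset.sum_nbij' (fun t => tᶜ) (fun t => tᶜ) ?_ ?_ ?_ ?_ ?_
  · intro t ht
    simp only [Finset.mem_powersetCard, Finset.subset_univ, true_and, Finset.card_compl,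
      Fintype.card_fin, Fin.val_castSucc, Fin.val_rev] at ht ⊢
    have := j.2
    omega
  · intro t ht
    simp only [Finset.mem_powersetCard, Finset.subset_univ, true_and, Finset.card_compl,
      Fintype.card_fin, Fin.val_castSucc, Fin.val_rev] at ht ⊢
    have := j.2
    omega
  · simp
  · simp
  · intro t _
    rw [← Finset.prod_mul_prod_compl t z, map_mul, mul_right_comm, map_prod,
      ← Finset.prod_mul_distrib]
    simp [hz']

lemma prod_one_sub_mul {n : ℕ} (z : Fin n → ℂ) {t : ℂ} (ht : t ≠ 0) :
    ∏ i, (1 - z i * t) =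
      1 + ∑ i : Fin n, (-1) ^ ((i : ℕ) + 1) * symmetrization n z i * t ^ ((i : ℕ) + 1) := by
  have h := eval_monicOfCoeffs_symmetrization z t⁻¹
  rw [eval_monicOfCoeffs] at h
  have h2 : ∏ i, (1 - z i * t) = t ^ n * ∏ i, (t⁻¹ - z i) := by
    have : t ^ n = ∏ _i : Fin n, t := by simp
    rw [this, ← Finset.prod_mul_distrib]
    refine Finset.prod_congr rfl fun i _ => ?_
    field_simp
  rw [h2, ← h, mul_add, Finset.mul_sum, ← mul_pow, mul_inv_cancel₀ ht, one_pow]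
  congr 1
  refine Finset.sum_congr rfl fun i _ => ?_
  have : t ^ n = t ^ ((i : ℕ) + 1) * t ^ (n - 1 - (i : ℕ)) := by
    rw [← pow_add]; congr 1; omega
  rw [this]
  have h3 : t ^ (n - 1 - (i : ℕ)) * t⁻¹ ^ (n - 1 - (i : ℕ)) = 1 := by
    rw [← mul_pow, mul_inv_cancel₀ ht, one_pow]
  linear_combination (-1) ^ ((i : ℕ) + 1) * symmetrization n z i * t ^ ((i : ℕ) + 1) * h3

-- For self-inversive `p` of degree `n = m + 1`, the polynomial `p - t p'/n` is a unimodular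
-- multiple of the reversal of `p'/n`, whose roots are the `q i`.
open ComplexConjugate in
lemma eval_sub_mul_eval_derivCoeffs {m : ℕ} {w : Fin (m + 1) → ℂ}
    (hlast : ‖w (Fin.last m)‖ = 1)
    (hrev : ∀ j : Fin m, conj (w (Fin.last m)) * w j.castSucc = conj (w j.rev.castSucc))
    {q : Fin m → ℂ} (hq : symmetrization m q = derivCoeffs w) {t : ℂ} (ht : t ≠ 0) :
    (monicOfCoeffs w).eval t - t * (monicOfCoeffs (derivCoeffs w)).eval t =
      (-1) ^ (m + 1) * w (Fin.last m) * ∏ i, (1 - conj (q i) * t) := by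
  have hm := natCast_add_one_ne_zero m
  have hrev' : ∀ j : Fin m, w (Fin.last m) * conj (w j.rev.castSucc) = w j.castSucc := fun j => by
    rw [← hrev j, ← mul_assoc, Complex.mul_conj, Complex.normSq_eq_norm_sq, hlast]
    simp
  have hconj : ∏ i, (1 - conj (q i) * t) =
      1 + ∑ i : Fin m, (-1) ^ ((i : ℕ) + 1) * conj (derivCoeffs w i) * t ^ ((i : ℕ) + 1) := by
    have h := prod_one_sub_mul q (t := conj t) (by simpa using ht)
    have h' := congrArg conj h
    simpa [map_prod, map_sum, hq] using h'
  rw [hconj, ← Equiv.sum_comp Fin.revPerm, eval_monicOfCoeffs, eval_monicOfCoeffs,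
    Fin.sum_univ_castSucc]
  simp only [Fin.revPerm_apply, Fin.val_last, Fin.val_castSucc, Nat.add_sub_cancel, Nat.sub_self,
    pow_zero, mul_one]
  have key : ∀ j : Fin m, (-1 : ℂ) ^ ((j : ℕ) + 1) * w j.castSucc * t ^ (m - (j : ℕ)) =
      t * ((-1) ^ ((j : ℕ) + 1) * derivCoeffs w j * t ^ (m - 1 - (j : ℕ))) +
      (-1) ^ (m + 1) * w (Fin.last m) *
        ((-1) ^ ((j.rev : ℕ) + 1) * conj (derivCoeffs w j.rev) * t ^ ((j.rev : ℕ) + 1)) := by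
    intro j
    have hj := j.2
    obtain ⟨k, hk⟩ : ∃ k, m = j + 1 + k := ⟨m - j - 1, by omega⟩
    have e1 : (j.rev : ℕ) = k := by rw [Fin.val_rev]; omega
    have e2 : m - 1 - (j : ℕ) = k := by omega
    have e3 : m - (j : ℕ) = k + 1 := by omega
    have hmc : (m : ℂ) = j + 1 + k := by exact_mod_cast hk
    have hc : conj (derivCoeffs w j.rev) =
        (((m : ℂ) - (k : ℂ)) / ((m : ℂ) + 1)) * conj (w j.rev.castSucc) := by
      simp only [derivCoeffs, e1, map_mul, map_div₀, map_sub, map_add, map_natCast, map_one]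
    have hs : (-1 : ℂ) ^ (m + 1) * (-1) ^ (k + 1) = (-1) ^ ((j : ℕ) + 1) := by
      rw [← pow_add, show m + 1 + (k + 1) = (j + 1) + 2 * (k + 1) by omega,
        pow_add, pow_mul]
      simp
    rw [hc, e1, e2, e3]
    have : (-1 : ℂ) ^ (m + 1) * w (Fin.last m) * ((-1) ^ (k + 1) *
        (((m : ℂ) - (k : ℂ)) / ((m : ℂ) + 1) * conj (w j.rev.castSucc)) * t ^ (k + 1)) =
        (-1) ^ ((j : ℕ) + 1) * (((m : ℂ) - (k : ℂ)) / ((m : ℂ) + 1)) * w j.castSucc *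
          t ^ (k + 1) := by
      rw [← hs, ← hrev' j]; ring
    rw [this, derivCoeffs]
    -- Since `j + k + 1 = m`, the weights at mirrored indices add up to one.
    have h1 : ((m : ℂ) - j) / (m + 1) + (m - k) / (m + 1) = 1 := by
      field_simp
      rw [hmc]; ring
    rw [pow_succ]
    linear_combination (-(-1 : ℂ) ^ ((j : ℕ) + 1) * w j.castSucc * (t ^ k * t)) * h1
  rw [Finset.sum_congr rfl fun j _ => key j, Finset.sum_add_distrib, ← Finset.mul_sum,
    ← Finset.mul_sum]
  ring

-- The Blaschke factor of a point of the closed disc has modulus at least one outside the open disc.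
open ComplexConjugate in
lemma norm_one_sub_conj_mul_le {q t : ℂ} (hq : ‖q‖ ≤ 1) (ht : 1 ≤ ‖t‖) :
    ‖1 - conj q * t‖ ≤ ‖t - q‖ := by
  have h1 : ‖1 - conj q * t‖ ^ 2 = ‖t - q‖ ^ 2 - (‖t‖ ^ 2 - 1) * (1 - ‖q‖ ^ 2) := by
    rw [← Complex.normSq_eq_norm_sq, ← Complex.normSq_eq_norm_sq, ← Complex.normSq_eq_norm_sq,
      ← Complex.normSq_eq_norm_sq]
    simp only [Complex.normSq_apply, Complex.sub_re, Complex.sub_im, Complex.mul_re,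
      Complex.mul_im, Complex.conj_re, Complex.conj_im, Complex.one_re, Complex.one_im]
    ring
  have h2 : 0 ≤ (‖t‖ ^ 2 - 1) * (1 - ‖q‖ ^ 2) := by
    apply mul_nonneg <;> nlinarith [norm_nonneg q]
  exact le_of_sq_le_sq (by linarith) (norm_nonneg _)

open ComplexConjugate in
/-- Cohn's theorem: a self-inversive polynomial whose critical points lie in the closed unit disc
has all its roots on the unit circle. -/
lemma mem_image_torus_of_selfInversive {m : ℕ} {w : Fin (m + 1) → ℂ}
    (hlast : ‖w (Fin.last m)‖ = 1)
    (hrev : ∀ j : Fin m, conj (w (Fin.last m)) * w j.castSucc = conj (w j.rev.castSucc))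
    (hderiv : derivCoeffs w ∈ Gamma m) :
    w ∈ symmetrization (m + 1) '' {z | ∀ i, ‖z i‖ = 1} := by
  obtain ⟨q, hq1, hq⟩ := hderiv
  have hΓ : w ∈ Gamma (m + 1) := by
    rw [mem_Gamma_iff]
    intro t ht
    by_contra! h
    have ht0 : t ≠ 0 := by rintro rfl; norm_num at h
    -- At a root `t` with `1 < ‖t‖` the identity gives `‖t‖ ∏ ‖t - q i‖ = ∏ ‖1 - conj (q i) t‖ ≤ ∏
    -- ‖t - q i‖`, which is absurd since the last product is positive.
    have key := eval_sub_mul_eval_derivCoeffs hlast hrev hq ht0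
    rw [ht, ← hq, eval_monicOfCoeffs_symmetrization, zero_sub] at key
    have key' := congrArg norm key
    simp only [norm_neg, norm_mul, norm_pow, norm_one, one_pow, hlast, one_mul, norm_prod] at key'
    have hle : ∏ i, ‖1 - conj (q i) * t‖ ≤ ∏ i, ‖t - q i‖ :=
      Finset.prod_le_prod (fun _ _ => norm_nonneg _)
        fun i _ => norm_one_sub_conj_mul_le (hq1 i) h.le
    have hpos : 0 < ∏ i, ‖t - q i‖ := Finset.prod_pos fun i _ => by
      rw [norm_pos_iff, sub_ne_zero]
      rintro rfl
      exact absurd (hq1 i) (not_le.2 h)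
    nlinarith
  obtain ⟨z, hz, rfl⟩ := hΓ
  refine ⟨z, fun i => (hz i).antisymm ?_, rfl⟩
  -- The moduli of the roots are at most one and have product one, so each equals one.
  rw [symmetrization_last, norm_prod, ← Finset.mul_prod_erase _ _ (Finset.mem_univ i)] at hlast
  have : ∏ j ∈ Finset.univ.erase i, ‖z j‖ ≤ 1 :=
    Finset.prod_le_one (fun _ _ => norm_nonneg _) fun j _ => hz j
  nlinarith [norm_nonneg (z i)]

/-! ### Polynomial convexity of `Γ_n`. -/

lemma continuous_symmetrization (n : ℕ) : Continuous (symmetrization n) :=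
  continuous_pi fun _ => MvPolynomial.continuous_eval _

lemma isCompact_polydisc (n : ℕ) : IsCompact {z : Fin n → ℂ | ∀ i, ‖z i‖ ≤ 1} := by
  have h : {z : Fin n → ℂ | ∀ i, ‖z i‖ ≤ 1} =
      Set.univ.pi fun _ => Metric.closedBall (0 : ℂ) 1 := by
    ext z; simp
  rw [h]
  exact isCompact_univ_pi fun _ => isCompact_closedBall _ _

lemma isCompact_Gamma (n : ℕ) : IsCompact (Gamma n) :=
  (isCompact_polydisc n).image (continuous_symmetrization n)

lemma norm_eval_le_supNormGamma {n : ℕ} (p : MvPolynomial (Fin n) ℂ) {w : Fin n → ℂ}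
    (hw : w ∈ Gamma n) : ‖MvPolynomial.eval w p‖ ≤ supNormGamma p :=
  le_csSup ((isCompact_Gamma n).image (MvPolynomial.continuous_eval p).norm).bddAbove
    ⟨w, hw, rfl⟩

lemma Gamma_nonempty (n : ℕ) : (Gamma n).Nonempty := ⟨_, 0, by simp, rfl⟩

lemma supNormGamma_nonneg {n : ℕ} (p : MvPolynomial (Fin n) ℂ) : 0 ≤ supNormGamma p :=
  let ⟨_, hw⟩ := Gamma_nonempty n
  (norm_nonneg _).trans (norm_eval_le_supNormGamma p hw)

/-- The fundamental theorem of symmetric polynomials; it makes symmetric polynomials on the polydisc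
available as test functions on `Γ_n`. -/
lemma exists_eval_symmetrization_eq {n : ℕ} {p : MvPolynomial (Fin n) ℂ} (hp : p.IsSymmetric) :
    ∃ q : MvPolynomial (Fin n) ℂ, ∀ z,
      MvPolynomial.eval (symmetrization n z) q = MvPolynomial.eval z p := by
  obtain ⟨q, hq⟩ := (MvPolynomial.esymmAlgHom_fin_bijective ℂ n).2 ⟨p, hp⟩
  refine ⟨q, fun z => ?_⟩
  have h := congrArg (fun r => MvPolynomial.aeval z r.1) hq
  simp only [MvPolynomial.esymmAlgHom_apply] at h
  rw [← AlgHom.comp_apply, MvPolynomial.comp_aeval] at h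
  exact h

lemma norm_symmetrization_le {n : ℕ} {z : Fin n → ℂ} (hz : ∀ i, ‖z i‖ ≤ 1) (j : Fin n) :
    ‖symmetrization n z j‖ ≤ 2 ^ n := by
  rw [symmetrization_apply]
  refine (norm_sum_le_of_le (n := fun _ => (1 : ℝ)) _ fun t _ => ?_).trans ?_
  · rw [norm_prod]
    exact Finset.prod_le_one (fun _ _ => norm_nonneg _) fun j _ => hz j
  · simp only [Finset.sum_const, Finset.card_powersetCard, Finset.card_univ, Fintype.card_fin,
      nsmul_eq_mul, mul_one]
    exact_mod_cast Nat.choose_le_two_pow _ _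

lemma norm_root_le_of_norm_symmetrization_le {n : ℕ} {z : Fin n → ℂ} {C : ℝ}
    (h : ∀ j, ‖symmetrization n z j‖ ≤ C) (i : Fin n) : ‖z i‖ ≤ max 1 (n * C) := by
  by_contra! hlt
  obtain ⟨h1, h2⟩ := max_lt_iff.1 hlt
  have h0 : (monicOfCoeffs (symmetrization n z)).eval (z i) = 0 := by
    rw [eval_monicOfCoeffs_symmetrization]
    exact Finset.prod_eq_zero (Finset.mem_univ i) (sub_self _)
  rw [eval_monicOfCoeffs, add_eq_zero_iff_eq_neg] at h0
  have hn : ‖z i‖ ^ n ≤ n * C * ‖z i‖ ^ (n - 1) := by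
    rw [← norm_pow, h0, norm_neg]
    refine (norm_sum_le_of_le (n := fun _ => C * ‖z i‖ ^ (n - 1)) _ fun j _ => ?_).trans ?_
    · simp only [norm_mul, norm_pow, norm_neg, norm_one, one_pow, one_mul]
      exact mul_le_mul (h j) (pow_le_pow_right₀ h1.le (Nat.sub_le _ _)) (by positivity)
        ((norm_nonneg _).trans (h j))
    · simp [mul_assoc]
  have hpos : 0 < ‖z i‖ ^ (n - 1) := by positivity
  have : ‖z i‖ ^ n = ‖z i‖ * ‖z i‖ ^ (n - 1) := by
    rw [← pow_succ']; congr 1; have := i.2; omega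
  rw [this] at hn
  exact absurd (le_of_mul_le_mul_right hn hpos) (not_le.2 h2)

/-- `Γ_n` is polynomially convex. -/
lemma mem_Gamma_of_forall_norm_eval_le {n : ℕ} {w : Fin n → ℂ}
    (h : ∀ p : MvPolynomial (Fin n) ℂ, ‖MvPolynomial.eval w p‖ ≤ supNormGamma p) :
    w ∈ Gamma n := by
  obtain ⟨z, rfl⟩ := symmetrization_surjective n w
  refine ⟨z, fun i => ?_, rfl⟩
  -- The elementary symmetric polynomials of the powers `z iᵏ` are polynomials in the point of
  -- `Γ_n`, bounded there by `2 ^ n` for every `k`. The root bound then controls `‖z i‖ ^ k`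
  -- uniformly in `k`, which forces `‖z i‖ ≤ 1`.
  have hbound : ∀ k : ℕ, ‖z i‖ ^ k ≤ max 1 ((n : ℝ) * 2 ^ n) := by
    intro k
    rw [← norm_pow]
    refine norm_root_le_of_norm_symmetrization_le (z := fun i => z i ^ k) (fun j => ?_) i
    have hsymm : (MvPolynomial.expand k
        (MvPolynomial.esymm (Fin n) ℂ ((j : ℕ) + 1))).IsSymmetric := fun e => by
      rw [MvPolynomial.rename_expand, MvPolynomial.rename_esymm]
    have heval : ∀ y : Fin n → ℂ, MvPolynomial.eval y (MvPolynomial.expand k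
        (MvPolynomial.esymm (Fin n) ℂ ((j : ℕ) + 1))) = symmetrization n (fun i => y i ^ k) j := by
      intro y
      rw [symmetrization, MvPolynomial.expand, ← MvPolynomial.aeval_eq_eval]
      simp [MvPolynomial.esymm]
    obtain ⟨q, hq⟩ := exists_eval_symmetrization_eq hsymm
    rw [← heval, ← hq]
    refine (h q).trans (csSup_le ((Gamma_nonempty n).image _) ?_)
    rintro _ ⟨_, ⟨y, hy, rfl⟩, rfl⟩
    simp only [hq, heval]
    exact norm_symmetrization_le (fun i => by rw [norm_pow]; exact pow_le_one₀ (norm_nonneg _) (hy i)) j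
  by_contra! hlt
  obtain ⟨k, hk⟩ := pow_unbounded_of_one_lt (max 1 ((n : ℝ) * 2 ^ n)) hlt
  exact absurd (hbound k) (not_le.2 hk)

end SymmetrizedDisc

/-! ### The distinguished boundary is the image of the torus. -/

namespace SymmetrizedDisc

open Filter Topology ComplexConjugate

/-- For `1 < ‖t‖` the polynomial with roots `z i` has modulus at least `c ‖t‖ⁿ` at `t`, and changing
its coefficients by at most `δ` changes the value by at most `n δ ‖t‖ⁿ`. The choice `δ = c / (n +
1)` keeps all roots in the disc. -/
lemma image_openPolydisc_subset_interior_Gamma {n : ℕ} {z : Fin n → ℂ} (hz : ∀ i, ‖z i‖ < 1) :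
    symmetrization n z ∈ interior (Gamma n) := by
  set c : ℝ := ∏ i, (1 - ‖z i‖) with hc
  have hcpos : 0 < c := Finset.prod_pos fun i _ => sub_pos.2 (hz i)
  have hn : (0 : ℝ) < n + 1 := by positivity
  rw [mem_interior_iff_mem_nhds, Metric.mem_nhds_iff]
  refine ⟨c / (n + 1), by positivity, fun w hw => ?_⟩
  rw [mem_Gamma_iff]
  intro t ht
  by_contra! h1
  have ht0 : 0 < ‖t‖ := by linarith
  have hle : c * ‖t‖ ^ n ≤ ‖(Polynomial.eval t (monicOfCoeffs (symmetrization n z)))‖ := by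
    rw [eval_monicOfCoeffs_symmetrization, norm_prod, hc]
    have : ‖t‖ ^ n = ∏ _i : Fin n, ‖t‖ := by simp
    rw [this, ← Finset.prod_mul_distrib]
    refine Finset.prod_le_prod (fun i _ => mul_nonneg (sub_pos.2 (hz i)).le ht0.le) fun i _ => ?_
    have h2 := norm_sub_norm_le t (z i)
    nlinarith [norm_nonneg (z i)]
  have hlt : ‖Polynomial.eval t (monicOfCoeffs (symmetrization n z))‖ ≤
      n * (c / (n + 1)) * ‖t‖ ^ n := by
    rw [← sub_zero (Polynomial.eval t _), ← ht, eval_monicOfCoeffs, eval_monicOfCoeffs,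
      add_sub_add_left_eq_sub, ← Finset.sum_sub_distrib]
    refine (norm_sum_le_of_le (n := fun _ => c / (n + 1) * ‖t‖ ^ n) _ fun j _ => ?_).trans ?_
    · rw [← sub_mul, ← mul_sub, norm_mul, norm_mul, norm_pow, norm_neg, norm_one, one_pow, one_mul,
        norm_pow]
      refine mul_le_mul ?_ (pow_le_pow_right₀ h1.le (by omega)) (by positivity) (by positivity)
      rw [← dist_eq_norm, dist_comm]
      exact (dist_le_pi_dist _ _ j).trans (Metric.mem_ball.1 hw).le
    · simp [mul_assoc]
  have hfinal : (n : ℝ) * (c / (n + 1)) < c := by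
    rw [mul_div_assoc', div_lt_iff₀ hn]
    nlinarith
  have hpos : 0 < ‖t‖ ^ n := by positivity
  nlinarith

lemma isCompact_torus (n : ℕ) : IsCompact {z : Fin n → ℂ | ∀ i, ‖z i‖ = 1} := by
  have h : {z : Fin n → ℂ | ∀ i, ‖z i‖ = 1} = Set.univ.pi fun _ => Metric.sphere (0 : ℂ) 1 := by
    ext z; simp
  rw [h]
  exact isCompact_univ_pi fun _ => isCompact_sphere _ _

/-- The one-variable maximum principle pushes the coordinates to the unit circle one at a time. -/
lemma exists_mem_torus_norm_le_of_differentiableAt {n : ℕ} {g : (Fin n → ℂ) → ℂ}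
    (hg : ∀ z : Fin n → ℂ, (∀ i, ‖z i‖ ≤ 1) → DifferentiableAt ℂ g z) {z : Fin n → ℂ}
    (hz : ∀ i, ‖z i‖ ≤ 1) : ∃ y : Fin n → ℂ, (∀ i, ‖y i‖ = 1) ∧ ‖g z‖ ≤ ‖g y‖ := by
  suffices h : ∀ s : Finset (Fin n), ∃ y : Fin n → ℂ, (∀ i, ‖y i‖ ≤ 1) ∧ (∀ i ∈ s, ‖y i‖ = 1) ∧
      ‖g z‖ ≤ ‖g y‖ by
    obtain ⟨y, -, hy, hle⟩ := h Finset.univ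
    exact ⟨y, fun i => hy i (Finset.mem_univ i), hle⟩
  intro s
  induction s using Finset.induction_on with
  | empty => exact ⟨z, hz, by simp, le_rfl⟩
  | insert i s hi ih =>
    obtain ⟨y, hy1, hys, hle⟩ := ih
    have hclosure : closure (Metric.ball (0 : ℂ) 1) = Metric.closedBall 0 1 :=
      closure_ball _ one_ne_zero
    have hup : ∀ t : ℂ, ‖t‖ ≤ 1 → ∀ j, ‖Function.update y i t j‖ ≤ 1 := fun t ht j => by
      by_cases hj : j = i
      · subst hj; simpa using ht
      · simpa [Function.update_of_ne hj] using hy1 j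
    have hdiff : DiffContOnCl ℂ (fun t => g (Function.update y i t)) (Metric.ball 0 1) := by
      refine DifferentiableOn.diffContOnCl fun t ht => ?_
      rw [hclosure, mem_closedBall_zero_iff] at ht
      exact ((hg _ (hup t ht)).comp t
        (hasFDerivAt_update y t).differentiableAt).differentiableWithinAt
    obtain ⟨t, ht, hmax⟩ := Complex.exists_mem_frontier_isMaxOn_norm Metric.isBounded_ball
      (Metric.nonempty_ball.2 one_pos) hdiff
    rw [frontier_ball _ one_ne_zero, mem_sphere_zero_iff_norm] at ht
    refine ⟨Function.update y i t, hup t ht.le, fun j hj => ?_, hle.trans ?_⟩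
    · by_cases hji : j = i
      · subst hji; simpa using ht
      · simpa [Function.update_of_ne hji] using hys j (Finset.mem_of_mem_insert_of_ne hj hji)
    · have := hmax (show y i ∈ _ by rw [hclosure]; simpa using hy1 i)
      simpa using this

/-- The maximum principle on the polydisc. -/
lemma exists_mem_torus_norm_le {n : ℕ} {g : (Fin n → ℂ) → ℂ}
    (hc : ContinuousOn g {z | ∀ i, ‖z i‖ ≤ 1})
    (hg : ∀ z : Fin n → ℂ, (∀ i, ‖z i‖ < 1) → DifferentiableAt ℂ g z) {z : Fin n → ℂ}
    (hz : ∀ i, ‖z i‖ ≤ 1) : ∃ y : Fin n → ℂ, (∀ i, ‖y i‖ = 1) ∧ ‖g z‖ ≤ ‖g y‖ := by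
  -- The dilates `x ↦ g (r k • x)` are differentiable on the whole closed polydisc; compactness of
  -- the torus allows passing to the limit `r k → 1`.
  let r : ℕ → ℂ := fun k => ((1 - 1 / ((k : ℝ) + 1) : ℝ) : ℂ)
  have hr1 : ∀ k, ‖r k‖ < 1 := fun k => by
    have h1 : (0 : ℝ) < 1 / ((k : ℝ) + 1) := by positivity
    have h2 : 1 / ((k : ℝ) + 1) ≤ 1 := by
      rw [div_le_one (by positivity)]; linarith [(Nat.cast_nonneg k : (0 : ℝ) ≤ k)]
    rw [Complex.norm_real, Real.norm_eq_abs, abs_lt]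
    constructor <;> linarith
  have hr : Tendsto r atTop (𝓝 1) := by
    have h := (tendsto_one_div_add_atTop_nhds_zero_nat (𝕜 := ℝ)).const_sub 1
    rw [sub_zero] at h
    exact (Complex.continuous_ofReal.tendsto 1).comp h
  have hrz : ∀ (k : ℕ) (y : Fin n → ℂ), (∀ i, ‖y i‖ ≤ 1) → ∀ i, ‖(r k • y) i‖ < 1 := by
    intro k y hy i
    rw [Pi.smul_apply, smul_eq_mul, norm_mul]
    nlinarith [hy i, hr1 k, norm_nonneg (r k), norm_nonneg (y i)]
  have hstep : ∀ k, ∃ y : Fin n → ℂ, (∀ i, ‖y i‖ = 1) ∧ ‖g (r k • z)‖ ≤ ‖g (r k • y)‖ := fun k =>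
    exists_mem_torus_norm_le_of_differentiableAt (g := fun x => g (r k • x))
      (fun x hx => (hg _ (hrz k x hx)).comp x (differentiableAt_id.const_smul (r k))) hz
  choose y hy1 hyle using hstep
  obtain ⟨a, ha, φ, hφ, hlim⟩ := (isCompact_torus n).tendsto_subseq hy1
  refine ⟨a, ha, ?_⟩
  have hrφ := hr.comp hφ.tendsto_atTop
  have hle1 : ∀ x : Fin n → ℂ, (∀ i, ‖x i‖ = 1) → ∀ i, ‖x i‖ ≤ 1 := fun x hx i => (hx i).le
  have t1 : Tendsto (fun k => r (φ k) • z) atTop (𝓝[{z | ∀ i, ‖z i‖ ≤ 1}] z) := by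
    refine tendsto_nhdsWithin_iff.2 ⟨?_, Eventually.of_forall fun k i => (hrz _ _ hz i).le⟩
    simpa using hrφ.smul_const z
  have t2 : Tendsto (fun k => r (φ k) • y (φ k)) atTop (𝓝[{z | ∀ i, ‖z i‖ ≤ 1}] a) := by
    refine tendsto_nhdsWithin_iff.2
      ⟨?_, Eventually.of_forall fun k i => (hrz _ _ (hle1 _ (hy1 _)) i).le⟩
    simpa using hrφ.smul hlim
  exact le_of_tendsto_of_tendsto' ((hc z hz).tendsto.comp t1).norm
    ((hc a (hle1 a ha)).tendsto.comp t2).norm fun k => hyle (φ k)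

lemma differentiable_symmetrization (n : ℕ) : Differentiable ℂ (symmetrization n) := by
  refine differentiable_pi.2 fun j => ?_
  simp only [symmetrization_apply]
  fun_prop

lemma isClosedBoundary_image_torus (n : ℕ) :
    IsClosedBoundary (Gamma n) (symmetrization n '' {z | ∀ i, ‖z i‖ = 1}) := by
  refine ⟨((isCompact_torus n).image (continuous_symmetrization n)).isClosed,
    Set.image_mono fun z hz i => (hz i).le, fun f hf => ?_⟩
  obtain ⟨_, ⟨z, hz, rfl⟩, hmax⟩ :=
    (isCompact_Gamma n).exists_isMaxOn (Gamma_nonempty n) hf.1.norm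
  obtain ⟨y, hy, hle⟩ := exists_mem_torus_norm_le (g := f ∘ symmetrization n)
    (hf.1.comp (continuous_symmetrization n).continuousOn (Set.mapsTo_image _ _))
    (fun x hx => (hf.2 _ (image_openPolydisc_subset_interior_Gamma hx)).differentiableAt.comp x
      (differentiable_symmetrization n x)) hz
  exact ⟨_, ⟨y, hy, rfl⟩, fun x hx => (hmax hx).trans hle⟩

lemma norm_half_one_add_conj_mul_lt {a z : ℂ} (ha : ‖a‖ = 1) (hz : ‖z‖ ≤ 1) (hne : z ≠ a) :
    ‖2⁻¹ * (1 + conj a * z)‖ < 1 := by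
  set v := conj a * z with hv
  have hv1 : ‖v‖ ≤ 1 := by rw [hv, norm_mul, Complex.norm_conj, ha, one_mul]; exact hz
  have hvne : v ≠ 1 := fun h => hne <| by
    have : a * v = z := by
      rw [hv, ← mul_assoc, Complex.mul_conj, Complex.normSq_eq_norm_sq, ha]; simp
    rw [← this, h, mul_one]
  have hsq : v.re * v.re + v.im * v.im ≤ 1 := by
    rw [← Complex.normSq_apply, Complex.normSq_eq_norm_sq]
    exact pow_le_one₀ (norm_nonneg _) hv1
  have hre : v.re < 1 := by
    by_contra! h
    have him : v.im = 0 := by nlinarith [mul_self_nonneg v.im]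
    exact hvne (Complex.ext (by simp; nlinarith) (by simpa using him))
  have : ‖1 + v‖ ^ 2 < 2 ^ 2 := by
    rw [← Complex.normSq_eq_norm_sq, Complex.normSq_apply]
    simp only [Complex.add_re, Complex.one_re, Complex.add_im, Complex.one_im]
    nlinarith
  have h2 := lt_of_pow_lt_pow_left₀ 2 (by norm_num) this
  rw [norm_mul, norm_inv, Complex.norm_ofNat]
  linarith

/-- The symmetric polynomial `∑_σ ∏ᵢ ((1 + conj ζᵢ X_{σ i}) / 2) ^ N`, which for large `N` peaks on the
closed polydisc near the orbit of `ζ`. -/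
noncomputable def peakPolynomial {n : ℕ} (ζ : Fin n → ℂ) (N : ℕ) : MvPolynomial (Fin n) ℂ :=
  ∑ σ : Equiv.Perm (Fin n), (∏ i, (MvPolynomial.C 2⁻¹ *
    (1 + MvPolynomial.C (conj (ζ i)) * MvPolynomial.X (σ i)))) ^ N

lemma isSymmetric_peakPolynomial {n : ℕ} (ζ : Fin n → ℂ) (N : ℕ) :
    (peakPolynomial ζ N).IsSymmetric := by
  intro e
  simp only [peakPolynomial, map_sum, map_pow, map_prod, map_mul, map_add, map_one,
    MvPolynomial.rename_C, MvPolynomial.rename_X]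
  exact Equiv.sum_comp (Equiv.mulLeft e) fun σ : Equiv.Perm (Fin n) =>
    (∏ i, ((MvPolynomial.C 2⁻¹ : MvPolynomial (Fin n) ℂ) *
      (1 + MvPolynomial.C (conj (ζ i)) * MvPolynomial.X (σ i)))) ^ N

lemma eval_peakPolynomial {n : ℕ} (ζ z : Fin n → ℂ) (N : ℕ) :
    MvPolynomial.eval z (peakPolynomial ζ N) =
      ∑ σ : Equiv.Perm (Fin n), (∏ i, (2⁻¹ * (1 + conj (ζ i) * z (σ i)))) ^ N := by
  simp [peakPolynomial]

lemma norm_peakFactor_lt {n : ℕ} {ζ z : Fin n → ℂ} (hζ : ∀ i, ‖ζ i‖ = 1) (hz : ∀ i, ‖z i‖ ≤ 1)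
    {σ : Equiv.Perm (Fin n)} (h : z ∘ σ ≠ ζ) :
    ‖∏ i, (2⁻¹ * (1 + conj (ζ i) * z (σ i)))‖ < 1 := by
  obtain ⟨i, hi⟩ := Function.ne_iff.1 h
  rw [norm_prod, ← Finset.mul_prod_erase _ _ (Finset.mem_univ i)]
  have h1 := norm_half_one_add_conj_mul_lt (hζ i) (hz (σ i)) hi
  have h2 : ∏ j ∈ Finset.univ.erase i, ‖2⁻¹ * (1 + conj (ζ j) * z (σ j))‖ ≤ 1 := by
    refine Finset.prod_le_one (fun _ _ => norm_nonneg _) fun j _ => ?_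
    by_cases hj : z (σ j) = ζ j
    · rw [hj, ← Complex.normSq_eq_conj_mul_self, Complex.normSq_eq_norm_sq, hζ j]
      norm_num
    · exact (norm_half_one_add_conj_mul_lt (hζ j) (hz (σ j)) hj).le
  have h3 : 0 ≤ ∏ j ∈ Finset.univ.erase i, ‖2⁻¹ * (1 + conj (ζ j) * z (σ j))‖ := by positivity
  nlinarith [norm_nonneg (2⁻¹ * (1 + conj (ζ i) * z (σ i)))]

lemma symmetrization_comp_perm {n : ℕ} (z : Fin n → ℂ) (σ : Equiv.Perm (Fin n)) :
    symmetrization n (z ∘ σ) = symmetrization n z := by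
  refine monicOfCoeffs_injective ?_
  rw [← prod_X_sub_C_eq_monicOfCoeffs, ← prod_X_sub_C_eq_monicOfCoeffs]
  exact Equiv.prod_comp σ fun i => Polynomial.X - Polynomial.C (z i)

/-- Permutations fixing `ζ` contribute exactly one and all others decay, so the limit counts the
stabilizer of `ζ`, which contains the identity. -/
lemma tendsto_eval_peakPolynomial {n : ℕ} {ζ : Fin n → ℂ} (hζ : ∀ i, ‖ζ i‖ = 1) :
    ∃ k : ℕ, k ≠ 0 ∧ Tendsto (fun N => MvPolynomial.eval ζ (peakPolynomial ζ N)) atTop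
      (𝓝 (k : ℂ)) := by
  classical
  refine ⟨(Finset.univ.filter fun σ : Equiv.Perm (Fin n) => ζ ∘ σ = ζ).card, ?_, ?_⟩
  · exact (Finset.card_pos.2 ⟨1, by simp⟩).ne'
  · simp only [eval_peakPolynomial, Finset.card_filter, Nat.cast_sum]
    refine tendsto_finsetSum _ fun σ _ => ?_
    split_ifs with h
    · have : ∏ i, (2⁻¹ * (1 + conj (ζ i) * ζ (σ i))) = 1 := Finset.prod_eq_one fun i _ => by
        rw [show ζ (σ i) = ζ i from congrFun h i, ← Complex.normSq_eq_conj_mul_self,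
          Complex.normSq_eq_norm_sq, hζ i]
        norm_num
      refine tendsto_const_nhds.congr fun N => ?_
      rw [this, one_pow, Nat.cast_one]
    · simpa using tendsto_pow_atTop_nhds_zero_of_norm_lt_one
        (norm_peakFactor_lt hζ (fun i => (hζ i).le) h)

lemma isAnalyticContinuous_eval {n : ℕ} (X : Set (Fin n → ℂ)) (p : MvPolynomial (Fin n) ℂ) :
    IsAnalyticContinuous X fun z => MvPolynomial.eval z p :=
  ⟨(MvPolynomial.continuous_eval p).continuousOn,
    (AnalyticOnNhd.eval_mvPolynomial p).mono (Set.subset_univ _)⟩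

/-- If the image of `ζ` were outside `B`, every factor of the peak polynomials would be bounded away
from one on the compact preimage of `B`. They would tend to zero uniformly there but not at `ζ`,
against the boundary property of `B`. -/
lemma symmetrization_mem_of_isClosedBoundary {n : ℕ} {B : Set (Fin n → ℂ)}
    (hB : IsClosedBoundary (Gamma n) B) {ζ : Fin n → ℂ} (hζ : ∀ i, ‖ζ i‖ = 1) :
    symmetrization n ζ ∈ B := by
  by_contra hmem
  set K : Set (Fin n → ℂ) := {z | ∀ i, ‖z i‖ ≤ 1} ∩ symmetrization n ⁻¹' B with hK
  have hKc : IsCompact K :=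
    (isCompact_polydisc n).inter_right (hB.1.preimage (continuous_symmetrization n))
  have hmax : ∀ N, ∃ z ∈ K, ‖MvPolynomial.eval ζ (peakPolynomial ζ N)‖ ≤
      ‖MvPolynomial.eval z (peakPolynomial ζ N)‖ := by
    intro N
    obtain ⟨q, hq⟩ := exists_eval_symmetrization_eq (isSymmetric_peakPolynomial ζ N)
    obtain ⟨y, hy, hle⟩ := hB.2.2 _ (isAnalyticContinuous_eval (Gamma n) q)
    obtain ⟨z, hz, rfl⟩ := hB.2.1 hy
    refine ⟨z, ⟨hz, hy⟩, ?_⟩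
    have := hle (symmetrization n ζ) ⟨ζ, fun i => (hζ i).le, rfl⟩
    rwa [hq, hq] at this
  choose z hzK hzle using hmax
  have hbound : ∀ σ : Equiv.Perm (Fin n), ∃ c : ℝ, 0 ≤ c ∧ c < 1 ∧
      ∀ x ∈ K, ‖∏ i, (2⁻¹ * (1 + conj (ζ i) * x (σ i)))‖ ≤ c := by
    intro σ
    have hcont : Continuous fun x : Fin n → ℂ =>
        ‖∏ i, (2⁻¹ * (1 + conj (ζ i) * x (σ i)))‖ := by fun_prop
    obtain ⟨x, hx, hxmax⟩ := hKc.exists_isMaxOn ⟨_, hzK 0⟩ hcont.continuousOn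
    refine ⟨_, norm_nonneg _, norm_peakFactor_lt (z := x) (σ := σ) hζ hx.1 fun h => hmem ?_, hxmax⟩
    rw [← h, symmetrization_comp_perm]
    exact hx.2
  choose c hc0 hc1 hc using hbound
  obtain ⟨k, hk0, hk⟩ := tendsto_eval_peakPolynomial hζ
  have hzero : Tendsto (fun N => ∑ σ, c σ ^ N) atTop (𝓝 0) := by
    simpa using tendsto_finsetSum Finset.univ fun σ _ =>
      tendsto_pow_atTop_nhds_zero_of_lt_one (hc0 σ) (hc1 σ)
  have hle : ∀ N, ‖MvPolynomial.eval ζ (peakPolynomial ζ N)‖ ≤ ∑ σ, c σ ^ N := fun N => by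
    refine (hzle N).trans ?_
    rw [eval_peakPolynomial]
    refine norm_sum_le_of_le _ fun σ _ => ?_
    rw [norm_pow]
    exact pow_le_pow_left₀ (norm_nonneg _) (hc σ _ (hzK N)) N
  have := tendsto_nhds_unique hk (squeeze_zero_norm hle hzero)
  exact hk0 (by exact_mod_cast this)

/-- The distinguished boundary of `Γ_n` is the image of the torus. -/
theorem distinguishedBoundary_eq (n : ℕ) :
    distinguishedBoundary n = symmetrization n '' {z | ∀ i, ‖z i‖ = 1} := by
  refine (Set.sInter_subset_of_mem (isClosedBoundary_image_torus n)).antisymm ?_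
  rintro _ ⟨ζ, hζ, rfl⟩ B hB
  exact symmetrization_mem_of_isClosedBoundary hB hζ

end SymmetrizedDisc

/-! ### Commuting normal operators, characters and the joint spectrum. -/

namespace SymmetrizedDisc

open ContinuousLinearMap InnerProductSpace

lemma polyEval_apply_of_intertwine {H K : Type*} [NormedAddCommGroup H] [InnerProductSpace ℂ H]
    [NormedAddCommGroup K] [InnerProductSpace ℂ K] {n : ℕ} {S : Fin n → H →L[ℂ] H}
    {T : Fin n → K →L[ℂ] K} (V : H →ₗ[ℂ] K) (h : ∀ i x, T i (V x) = V (S i x))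
    (p : MvPolynomial (Fin n) ℂ) (x : H) : polyEval T p (V x) = V (polyEval S p x) := by
  have hpow : ∀ (i : Fin n) (k : ℕ) (y : H), (T i ^ k) (V y) = V ((S i ^ k) y) := by
    intro i k
    induction k with
    | zero => simp
    | succ k ih => intro y; simp [pow_succ, h, ih]
  have hprod : ∀ (m : Fin n → ℕ) (l : List (Fin n)) (y : H),
      ((l.map fun i => T i ^ m i).prod) (V y) = V ((l.map fun i => S i ^ m i).prod y) := by
    intro m l
    induction l with
    | nil => simp
    | cons i l ih => intro y; simp [ih, hpow]
  simp only [polyEval, List.ofFn_eq_map, sum_apply, smul_apply, map_sum, map_smul]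
  exact Finset.sum_congr rfl fun m _ => by rw [hprod]

/-- A tuple of commuting normal operators lies in a commutative unital C⋆-algebra of operators. -/
theorem exists_commCStarAlgebra {K : Type u} [NormedAddCommGroup K] [InnerProductSpace ℂ K]
    [CompleteSpace K] {n : ℕ} {T : Fin n → K →L[ℂ] K} (hcomm : ∀ i j, Commute (T i) (T j))
    (hnormal : ∀ i, IsStarNormal (T i)) :
    ∃ (A : Type u) (_ : CommCStarAlgebra A) (φ : A →⋆ₐ[ℂ] (K →L[ℂ] K)) (a : Fin n → A),
      (∀ i, φ (a i) = T i) ∧ (∀ x, ‖φ x‖ = ‖x‖) ∧ ∀ x, IsUnit (φ x) → IsUnit x := by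
  have h1 : ∀ a ∈ Set.range T, ∀ b ∈ Set.range T, a * b = b * a := by
    rintro _ ⟨i, rfl⟩ _ ⟨j, rfl⟩
    exact hcomm i j
  have h2 : ∀ a ∈ Set.range T, ∀ b ∈ Set.range T, a * star b = star b * a := by
    rintro _ ⟨i, rfl⟩ _ ⟨j, rfl⟩
    -- Fuglede's theorem.
    exact (hnormal j).commute_star_right (hcomm i j)
  have hmul := StarAlgebra.isMulCommutative_adjoin ℂ h1 h2
  let A := (StarAlgebra.adjoin ℂ (Set.range T)).topologicalClosure
  let R : CommRing A := StarSubalgebra.commRingTopologicalClosure _ fun x y =>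
    mul_comm' x y
  have hclosed : IsClosed (A : Set (K →L[ℂ] K)) := StarSubalgebra.isClosed_topologicalClosure _
  let C : CommCStarAlgebra A :=
    { (inferInstance : CStarAlgebra A) with mul_comm := R.mul_comm }
  refine ⟨A, C, A.subtype, fun i => ⟨T i, StarSubalgebra.le_topologicalClosure _
    (StarAlgebra.subset_adjoin ℂ _ ⟨i, rfl⟩)⟩, fun i => rfl, fun x => rfl, fun x hx => ?_⟩
  -- Spectral permanence: inverses stay in a closed star subalgebra.
  exact (StarSubalgebra.coe_isUnit A).1 hx

section Characters

variable {A : Type*} [CommCStarAlgebra A]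

open WeakDual

/-- The Gelfand transform is isometric. -/
lemma norm_le_of_forall_character {a : A} {C : ℝ} (hC : 0 ≤ C)
    (h : ∀ χ : characterSpace ℂ A, ‖χ a‖ ≤ C) : ‖a‖ ≤ C := by
  have h1 := (AddMonoidHomClass.isometry_iff_norm (gelfandTransform ℂ A)).1
    (gelfandTransform_isometry A) a
  rw [← h1, ContinuousMap.norm_le _ hC]
  exact h

lemma eq_of_forall_character {a b : A} (h : ∀ χ : characterSpace ℂ A, χ a = χ b) : a = b := by
  refine sub_eq_zero.1 (norm_le_zero_iff.1 (norm_le_of_forall_character le_rfl fun χ => ?_))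
  rw [map_sub, h, sub_self, norm_zero]

lemma norm_character_le (χ : characterSpace ℂ A) (a : A) : ‖χ a‖ ≤ ‖a‖ := by
  have h1 := (AddMonoidHomClass.isometry_iff_norm (gelfandTransform ℂ A)).1
    (gelfandTransform_isometry A) a
  rw [← h1]
  exact (gelfandTransform ℂ A a).norm_coe_le_norm χ

lemma character_aeval (χ : characterSpace ℂ A) {n : ℕ} (a : Fin n → A)
    (p : MvPolynomial (Fin n) ℂ) :
    χ (MvPolynomial.aeval a p) = MvPolynomial.eval (fun i => χ (a i)) p := by
  simp [MvPolynomial.aeval_def, MvPolynomial.eval₂_eq', MvPolynomial.eval_eq', map_sum, map_mul,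
    map_prod, map_pow, AlgHomClass.commutes]

variable {K : Type*} [NormedAddCommGroup K] [InnerProductSpace ℂ K] [CompleteSpace K]

lemma map_aeval_eq_polyEval (φ : A →⋆ₐ[ℂ] (K →L[ℂ] K)) {n : ℕ} (a : Fin n → A)
    (p : MvPolynomial (Fin n) ℂ) :
    φ (MvPolynomial.aeval a p) = polyEval (fun i => φ (a i)) p := by
  rw [MvPolynomial.aeval_def, MvPolynomial.eval₂_eq', map_sum, polyEval]
  refine Finset.sum_congr rfl fun m _ => ?_
  rw [map_mul, AlgHomClass.commutes, ← Algebra.smul_def, ← List.prod_ofFn, map_list_prod,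
    List.map_ofFn]
  congr 3
  funext i
  simp

/-- By Cauchy-Schwarz the left inverse gives `‖x‖² ≤ (∑ ‖B i‖²) ∑ ‖Y i x‖²`, so the quadratic form
of `∑ Yᵢ* Yᵢ` is bounded below. The added `1` in `c` keeps the denominator positive when every `B i`
vanishes. -/
lemma isUnit_sum_star_mul_of_left_inverse {n : ℕ} {Y B : Fin n → K →L[ℂ] K}
    (h : ∑ i, B i * Y i = 1) : IsUnit (∑ i, star (Y i) * Y i) := by
  set c : ℝ := (∑ i, ‖B i‖ ^ 2 + 1)⁻¹ with hc
  have hpos : 0 < ∑ i, ‖B i‖ ^ 2 + 1 := by positivity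
  have hcpos : 0 < c := by positivity
  refine ContinuousLinearMap.isUnit_of_forall_le_norm_inner_map _ (c := ⟨c, hcpos.le⟩) hcpos
    fun x => ?_
  have hinner : (inner ℂ ((∑ i, star (Y i) * Y i) x) x : ℂ) =
      ((∑ i, ‖Y i x‖ ^ 2 : ℝ) : ℂ) := by
    rw [sum_apply, sum_inner]
    push_cast
    refine Finset.sum_congr rfl fun i _ => ?_
    change inner ℂ (adjoint (Y i) (Y i x)) x = _
    rw [adjoint_inner_left, inner_self_eq_norm_sq_to_K]
    rfl
  have hx : ‖x‖ ≤ ∑ i, ‖B i‖ * ‖Y i x‖ := by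
    have := congrArg (fun F : K →L[ℂ] K => F x) h
    simp only [sum_apply] at this
    change _ = x at this
    conv_lhs => rw [← this]
    exact norm_sum_le_of_le _ fun i _ => (B i).le_opNorm (Y i x)
  have hsq : ‖x‖ ^ 2 ≤ (∑ i, ‖B i‖ ^ 2) * ∑ i, ‖Y i x‖ ^ 2 :=
    (pow_le_pow_left₀ (norm_nonneg _) hx 2).trans (Finset.sum_mul_sq_le_sq_mul_sq _ _ _)
  have hnn : 0 ≤ ∑ i, ‖Y i x‖ ^ 2 := by positivity
  rw [hinner, Complex.norm_real, Real.norm_of_nonneg hnn]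
  change ‖x‖ ^ 2 * c ≤ _
  rw [hc, ← div_eq_mul_inv, div_le_iff₀ hpos]
  nlinarith

/-- The joint spectrum of commuting normal operators consists of the values of the characters of a
commutative C⋆-algebra containing them. -/
lemma mem_jointSpectrum_iff_exists_character (φ : A →⋆ₐ[ℂ] (K →L[ℂ] K))
    (hφ : ∀ x, IsUnit (φ x) → IsUnit x) {n : ℕ} (a : Fin n → A) (w : Fin n → ℂ) :
    w ∈ jointSpectrum (fun i => φ (a i)) ↔ ∃ χ : characterSpace ℂ A, ∀ i, χ (a i) = w i := by
  set y : Fin n → A := fun i => a i - w i • 1 with hy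
  have hφy : ∀ i, φ (a i) - w i • 1 = φ (y i) := fun i => by
    rw [hy, map_sub, map_smul, map_one]
  have hD : φ (∑ i, star (y i) * y i) = ∑ i, star (φ (y i)) * φ (y i) := by
    simp [map_sum, map_mul, map_star]
  simp only [jointSpectrum, hφy, Set.mem_ofPred_eq]
  constructor
  · intro h
    -- An inverse of `∑ yᵢ* yᵢ` would give both a left and a right inverse of the tuple. A character
    -- killing this sum kills each `y i`, because its value is `∑ |χ (y i)|²`.
    have hnu : ¬ IsUnit (∑ i, star (y i) * y i) := by
      rintro ⟨u, hu⟩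
      refine h ⟨⟨fun i => φ (↑u⁻¹ * star (y i)), ?_⟩, ⟨fun i => φ (↑u⁻¹ * star (y i)), ?_⟩⟩
      · simp_rw [← map_mul, ← map_sum, mul_assoc, ← Finset.mul_sum, ← hu, Units.inv_mul, map_one]
      · have : ∀ i, y i * (↑u⁻¹ * star (y i)) = ↑u⁻¹ * (star (y i) * y i) := fun i => by ring
        simp_rw [← map_mul, ← map_sum, this, ← Finset.mul_sum, ← hu, Units.inv_mul, map_one]
    obtain ⟨χ, hχ⟩ := CharacterSpace.exists_apply_eq_zero hnu
    refine ⟨χ, fun i => ?_⟩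
    have hsum : ∑ i, ‖χ (y i)‖ ^ 2 = 0 := by
      have : ((∑ i, ‖χ (y i)‖ ^ 2 : ℝ) : ℂ) = 0 := by
        rw [← hχ, map_sum]
        push_cast
        refine Finset.sum_congr rfl fun i _ => ?_
        rw [map_mul, map_star, ← Complex.ofReal_pow, ← Complex.normSq_eq_norm_sq,
          Complex.normSq_eq_conj_mul_self]
        rfl
      exact_mod_cast this
    have hi := (Finset.sum_eq_zero_iff_of_nonneg fun i _ => by positivity).1 hsum i
      (Finset.mem_univ i)
    have : χ (y i) = 0 := norm_eq_zero.1 (pow_eq_zero_iff two_ne_zero |>.1 hi)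
    rw [hy] at this
    simpa [sub_eq_zero] using this
  · rintro ⟨χ, hχ⟩ ⟨⟨B, hB⟩, -⟩
    have hu := isUnit_sum_star_mul_of_left_inverse hB
    rw [← hD] at hu
    have hu' := (hφ _ hu).map χ
    have h0 : ∀ i, χ (y i) = 0 := fun i => by simp [hy, hχ]
    simp [map_sum, map_mul, h0] at hu'

end Characters

/-- The operator identities `Sₙ* Sₙ = 1`, `Sₙ* Sᵢ = Sₙ₋ᵢ*`, together with `(γᵢ Sᵢ)` being a
`Γ_{n-1}`-contraction. -/
def IsometryCriterion {H : Type*} [NormedAddCommGroup H] [InnerProductSpace ℂ H]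
    [CompleteSpace H] {m : ℕ} (S : Fin (m + 1) → H →L[ℂ] H) : Prop :=
  adjoint (S (Fin.last m)) * S (Fin.last m) = 1 ∧
    (∀ j : Fin m, adjoint (S (Fin.last m)) * S j.castSucc = adjoint (S j.rev.castSucc)) ∧
    IsGammaContraction
      (fun j : Fin m => (((m : ℂ) - ((j : ℕ) : ℂ)) / ((m : ℂ) + 1)) • S j.castSucc)

/-! ### `Γ_n`-unitaries and the criterion. -/

section Unitary

variable {K : Type u} [NormedAddCommGroup K] [InnerProductSpace ℂ K] [CompleteSpace K] {m : ℕ}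
  {T : Fin (m + 1) → K →L[ℂ] K}

open ComplexConjugate

/-- Every character sends the tuple to the image of a point of the torus, where the three conditions
are scalar facts about roots on the circle. -/
theorem IsGammaUnitary.isometryCriterion (hT : IsGammaUnitary T) : IsometryCriterion T := by
  obtain ⟨hcomm, hnormal, hspec⟩ := hT
  obtain ⟨A, _, φ, a, ha, hnorm, hunit⟩ := exists_commCStarAlgebra hcomm hnormal
  obtain rfl : (fun i => φ (a i)) = T := funext ha
  have hchar : ∀ χ : WeakDual.characterSpace ℂ A, ∃ z : Fin (m + 1) → ℂ, (∀ i, ‖z i‖ = 1) ∧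
      symmetrization (m + 1) z = fun i => χ (a i) := by
    intro χ
    have := hspec ((mem_jointSpectrum_iff_exists_character φ hunit a _).2 ⟨χ, fun i => rfl⟩)
    rwa [distinguishedBoundary_eq] at this
  refine ⟨?_, fun j => ?_, fun i j => ?_, fun p => ?_⟩
  · have : star (a (Fin.last m)) * a (Fin.last m) = 1 := by
      refine eq_of_forall_character fun χ => ?_
      obtain ⟨z, hz, hzχ⟩ := hchar χ
      rw [map_mul, map_star, map_one]
      change conj (χ (a (Fin.last m))) * _ = _
      rw [← Complex.normSq_eq_conj_mul_self, Complex.normSq_eq_norm_sq, ← congrFun hzχ,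
        symmetrization_last, norm_prod]
      simp [hz]
    rw [← star_eq_adjoint, ← map_star, ← map_mul, this, map_one]
  · have : star (a (Fin.last m)) * a j.castSucc = star (a j.rev.castSucc) := by
      refine eq_of_forall_character fun χ => ?_
      obtain ⟨z, hz, hzχ⟩ := hchar χ
      rw [map_mul, map_star, map_star]
      change conj (χ (a (Fin.last m))) * χ (a j.castSucc) = conj (χ (a j.rev.castSucc))
      have := conj_symmetrization_last_mul hz j
      rwa [hzχ] at this
    rw [← star_eq_adjoint, ← star_eq_adjoint, ← map_star, ← map_mul, this, map_star]
  · exact ((hcomm _ _).smul_left _).smul_right _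
  · simp_rw [← map_smul]
    rw [← map_aeval_eq_polyEval, hnorm]
    refine norm_le_of_forall_character (supNormGamma_nonneg p) fun χ => ?_
    rw [character_aeval]
    refine norm_eval_le_supNormGamma p ?_
    obtain ⟨z, hz, hzχ⟩ := hchar χ
    have := derivCoeffs_mem_Gamma (w := symmetrization (m + 1) z) ⟨z, fun i => (hz i).le, rfl⟩
    rw [hzχ] at this
    simp only [map_smul, smul_eq_mul]
    exact this

/-- Surjectivity makes the last operator unitary, and the relations then make all others normal. At
each character the relations say that the polynomial is self-inversive, polynomial convexity places
its critical points in the disc, and Cohn's theorem applies. -/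
theorem IsometryCriterion.isGammaUnitary (hT : IsometryCriterion T)
    (hcomm : ∀ i j, Commute (T i) (T j)) (hsurj : Function.Surjective (T (Fin.last m))) :
    IsGammaUnitary T := by
  obtain ⟨hiso, hrel, hcontr⟩ := hT
  have hco : T (Fin.last m) * adjoint (T (Fin.last m)) = 1 := by
    ext x
    obtain ⟨y, rfl⟩ := hsurj x
    have := congrArg (fun F : K →L[ℂ] K => T (Fin.last m) (F y)) hiso
    simpa using this
  have hadj : ∀ i, Commute (adjoint (T (Fin.last m))) (T i) := by
    intro i
    have h := hcomm (Fin.last m) i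
    calc adjoint (T (Fin.last m)) * T i
        = adjoint (T (Fin.last m)) * (T i * T (Fin.last m)) * adjoint (T (Fin.last m)) := by
          rw [mul_assoc, mul_assoc, hco, mul_one]
      _ = T i * adjoint (T (Fin.last m)) := by
          rw [← h.eq, ← mul_assoc, hiso, one_mul]
  have hnormal : ∀ i, IsStarNormal (T i) := by
    intro i
    refine ⟨?_⟩
    rw [star_eq_adjoint]
    refine Fin.lastCases (hadj _) (fun j => ?_) i
    -- The relation at the mirrored index writes the adjoint of `T j` as a product of two operators
    -- commuting with `T j`.
    have h := hrel j.rev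
    rw [Fin.rev_rev] at h
    rw [← h]
    exact (hadj _).mul_left (hcomm _ _)
  refine ⟨hcomm, hnormal, fun w hw => ?_⟩
  obtain ⟨A, _, φ, a, ha, hnorm, hunit⟩ := exists_commCStarAlgebra hcomm hnormal
  obtain rfl : (fun i => φ (a i)) = T := funext ha
  obtain ⟨χ, hχ⟩ := (mem_jointSpectrum_iff_exists_character φ hunit a w).1 hw
  have hinj : Function.Injective φ := fun x y h => by
    rw [← sub_eq_zero, ← norm_eq_zero, ← hnorm, map_sub, h, sub_self, norm_zero]
  rw [distinguishedBoundary_eq]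
  refine mem_image_torus_of_selfInversive ?_ (fun j => ?_)
    (mem_Gamma_of_forall_norm_eval_le fun p => ?_)
  · have h1 : star (a (Fin.last m)) * a (Fin.last m) = 1 := hinj (by
      rw [map_mul, map_star, map_one]; exact hiso)
    have h2 := congrArg χ h1
    rw [map_mul, map_star, map_one, hχ] at h2
    change conj (w (Fin.last m)) * _ = _ at h2
    rw [← Complex.normSq_eq_conj_mul_self, Complex.normSq_eq_norm_sq] at h2
    exact (pow_eq_one_iff_of_nonneg (norm_nonneg _) two_ne_zero).1 (by exact_mod_cast h2)
  · have h1 : star (a (Fin.last m)) * a j.castSucc = star (a j.rev.castSucc) := hinj (by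
      rw [map_mul, map_star, map_star]; exact hrel j)
    have h2 := congrArg χ h1
    rwa [map_mul, map_star, map_star, hχ, hχ, hχ] at h2
  · have h := hcontr.2 p
    simp_rw [← map_smul] at h
    rw [← map_aeval_eq_polyEval, hnorm] at h
    refine le_trans ?_ h
    refine le_of_eq_of_le ?_ (norm_character_le χ _)
    rw [character_aeval]
    simp only [map_smul, hχ, smul_eq_mul]
    rfl

end Unitary

end SymmetrizedDisc

/-! ### The unitary extension of an isometry. -/

namespace SymmetrizedDisc

open ContinuousLinearMap InnerProductSpace Filter Topology

section UnitaryExtension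

variable {H : Type u} [NormedAddCommGroup H] [InnerProductSpace ℂ H]

/-- The sequences that eventually are orbits of the isometry `W`. -/
def eventualOrbits (W : H →ₗᵢ[ℂ] H) : Submodule ℂ (ℕ → H) where
  carrier := {x | ∀ᶠ k in atTop, x (k + 1) = W (x k)}
  add_mem' hx hy := by
    filter_upwards [hx, hy] with k h1 h2
    simp [h1, h2]
  zero_mem' := by simp
  smul_mem' c x hx := by
    filter_upwards [hx] with k h
    simp [h]

/-- The eventual orbits of `W`, with the limit of the inner products of the entries: a dense part of
the space of the minimal unitary extension of `W`. -/
def EventualOrbit (W : H →ₗᵢ[ℂ] H) : Type u := eventualOrbits W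

namespace EventualOrbit

variable (W : H →ₗᵢ[ℂ] H)

noncomputable instance : AddCommGroup (EventualOrbit W) :=
  inferInstanceAs (AddCommGroup (eventualOrbits W))

noncomputable instance : Module ℂ (EventualOrbit W) :=
  inferInstanceAs (Module ℂ (eventualOrbits W))

variable {W}

/-- `W` preserves inner products, so they are constant once both sequences have become orbits. -/
lemma exists_eventually_inner_eq (x y : EventualOrbit W) :
    ∃ c : ℂ, ∀ᶠ k in atTop, inner ℂ (x.1 k) (y.1 k) = c := by
  obtain ⟨N, hN⟩ := eventually_atTop.1 (x.2.and y.2)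
  refine ⟨inner ℂ (x.1 N) (y.1 N), eventually_atTop.2 ⟨N, fun k hk => ?_⟩⟩
  induction k, hk using Nat.le_induction with
  | base => rfl
  | succ k hk ih => rw [(hN k hk).1, (hN k hk).2, W.inner_map_map, ih]

/-- The eventual value of the inner product of the entries. -/
noncomputable def limInner (x y : EventualOrbit W) : ℂ := (exists_eventually_inner_eq x y).choose

lemma eventually_inner_eq (x y : EventualOrbit W) :
    ∀ᶠ k in atTop, inner ℂ (x.1 k) (y.1 k) = limInner x y :=
  (exists_eventually_inner_eq x y).choose_spec

variable (W)

/-- The semidefinite inner product on eventual orbits. -/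
@[reducible]
noncomputable def core : PreInnerProductSpace.Core ℂ (EventualOrbit W) where
  inner := limInner
  conj_inner_symm x y := by
    obtain ⟨k, h1, h2⟩ := ((eventually_inner_eq y x).and (eventually_inner_eq x y)).exists
    rw [← h1, ← h2, inner_conj_symm]
  re_inner_nonneg x := by
    obtain ⟨k, h⟩ := (eventually_inner_eq x x).exists
    rw [← h]
    exact inner_self_nonneg
  add_left x y z := by
    obtain ⟨k, h1, h2, h3⟩ := ((eventually_inner_eq (x + y) z).and
      ((eventually_inner_eq x z).and (eventually_inner_eq y z))).exists
    rw [← h1, ← h2, ← h3, ← inner_add_left]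
    rfl
  smul_left x y r := by
    obtain ⟨k, h1, h2⟩ := ((eventually_inner_eq (r • x) y).and (eventually_inner_eq x y)).exists
    rw [← h1, ← h2, ← inner_smul_left]
    rfl

noncomputable instance : SeminormedAddCommGroup (EventualOrbit W) :=
  @InnerProductSpace.Core.toSeminormedAddCommGroup ℂ _ _ _ _ (core W)

noncomputable instance : InnerProductSpace ℂ (EventualOrbit W) := InnerProductSpace.ofCore (core W)

variable {W}

lemma eventually_norm_eq (x : EventualOrbit W) : ∀ᶠ k in atTop, ‖x.1 k‖ = ‖x‖ := by
  filter_upwards [eventually_inner_eq x x] with k hk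
  rw [norm_eq_sqrt_re_inner (𝕜 := ℂ), norm_eq_sqrt_re_inner (𝕜 := ℂ), hk]
  rfl

lemma norm_sub_eq_zero {x y : EventualOrbit W} (h : ∀ᶠ k in atTop, x.1 k = y.1 k) :
    ‖x - y‖ = 0 := by
  obtain ⟨k, h1, h2⟩ := (h.and (eventually_norm_eq (x - y))).exists
  rw [← h2]
  change ‖x.1 k - y.1 k‖ = 0
  rw [h1, sub_self, norm_zero]

/-- The orbit of a vector, started at time `k`, as a linear map. -/
noncomputable def orbitLinear (W : H →ₗᵢ[ℂ] H) (k : ℕ) : H →ₗ[ℂ] EventualOrbit W where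
  -- For `j < k` truncated subtraction makes the entry `h`; only the tail affects the seminorm.
  toFun h := ⟨fun j => (W ^ (j - k)) h, eventually_atTop.2 ⟨k, fun j hj => by
    change (W ^ (j + 1 - k)) h = W ((W ^ (j - k)) h)
    rw [Nat.sub_add_comm hj, pow_succ']
    rfl⟩⟩
  map_add' x y := Subtype.ext (funext fun j => map_add _ _ _)
  map_smul' c x := Subtype.ext (funext fun j => map_smul _ _ _)

/-- The orbit of a vector, started at time `k`. -/
noncomputable def orbit (W : H →ₗᵢ[ℂ] H) (k : ℕ) : H →ₗᵢ[ℂ] EventualOrbit W where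
  __ := orbitLinear W k
  norm_map' x := by
    obtain ⟨j, hj⟩ := (eventually_norm_eq (orbitLinear W k x)).exists
    exact hj.symm.trans ((W ^ (j - k)).norm_map x)

/-- The entrywise action of an operator commuting with `W` on eventual orbits. -/
noncomputable def liftLinear (A : H →L[ℂ] H) (hA : ∀ x, A (W x) = W (A x)) :
    EventualOrbit W →ₗ[ℂ] EventualOrbit W where
  toFun x := ⟨fun k => A (x.1 k), by
    filter_upwards [x.2] with k hk
    rw [hk, hA]⟩
  map_add' x y := Subtype.ext (funext fun j => map_add A _ _)
  map_smul' c x := Subtype.ext (funext fun j => map_smul A _ _)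

/-- The bounded action of an operator commuting with `W` on eventual orbits. -/
noncomputable def lift (A : H →L[ℂ] H) (hA : ∀ x, A (W x) = W (A x)) :
    EventualOrbit W →L[ℂ] EventualOrbit W :=
  (liftLinear A hA).mkContinuous ‖A‖ fun x => by
    obtain ⟨k, h1, h2⟩ :=
      ((eventually_norm_eq x).and (eventually_norm_eq (liftLinear A hA x))).exists
    rw [← h1, ← h2]
    exact A.le_opNorm _

end EventualOrbit

open UniformSpace in
/-- The unitary extension of an isometry, as an increasing union of copies of the space. -/
theorem exists_unitaryExtension (W : H →ₗᵢ[ℂ] H) :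
    ∃ (K : Type u) (_ : NormedAddCommGroup K) (_ : InnerProductSpace ℂ K) (_ : CompleteSpace K)
      (V : ℕ → H →ₗᵢ[ℂ] K), (∀ k x, V (k + 1) (W x) = V k x) ∧
        Dense (⋃ k, Set.range (V k)) ∧
        ∀ A : H →L[ℂ] H, (∀ x, A (W x) = W (A x)) →
          ∃ B : K →L[ℂ] K, ∀ k x, B (V k x) = V k (A x) := by
  have hcoe : ∀ x y : EventualOrbit W, (∀ᶠ k in atTop, x.1 k = y.1 k) →
      (x : Completion (EventualOrbit W)) = y := fun x y h => by
    rw [← sub_eq_zero, ← Completion.coe_sub, ← norm_eq_zero, Completion.norm_coe,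
      EventualOrbit.norm_sub_eq_zero h]
  refine ⟨Completion (EventualOrbit W), inferInstance, inferInstance, inferInstance,
    fun k => Completion.toComplₗᵢ.comp (EventualOrbit.orbit W k), fun k x => ?_, ?_,
    fun A hA => ⟨(EventualOrbit.lift A hA).completion, fun k x => ?_⟩⟩
  · refine hcoe _ _ (eventually_atTop.2 ⟨k + 1, fun j hj => ?_⟩)
    change (W ^ (j - (k + 1))) (W x) = (W ^ (j - k)) x
    rw [show j - k = j - (k + 1) + 1 by omega, pow_succ]
    rfl
  -- A sequence that is an orbit from time `N` on agrees eventually with the orbit of its `N`-th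
  -- entry started at time `N`.
  · refine (Completion.denseRange_coe (α := EventualOrbit W)).mono ?_
    rintro _ ⟨x, rfl⟩
    obtain ⟨N, hN⟩ := eventually_atTop.1 x.2
    refine Set.mem_iUnion.2 ⟨N, x.1 N, hcoe _ _ (eventually_atTop.2 ⟨N, fun j hj => ?_⟩)⟩
    change (W ^ (j - N)) (x.1 N) = x.1 j
    induction j, hj using Nat.le_induction with
    | base => simp
    | succ j hj ih =>
      rw [hN j hj, ← ih, Nat.sub_add_comm hj, pow_succ']
      rfl
  · refine (completion_apply_coe _ _).trans (hcoe _ _ (Eventually.of_forall fun j => ?_))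
    change A ((W ^ (j - k)) x) = (W ^ (j - k)) (A x)
    induction j - k with
    | zero => rfl
    | succ i ih =>
      rw [pow_succ']
      change A (W ((W ^ i) x)) = W ((W ^ i) (A x))
      rw [hA, ih]

end UnitaryExtension

/-! ### The criterion under restriction and unitary extension. -/

section Criterion

variable {H : Type u} [NormedAddCommGroup H] [InnerProductSpace ℂ H] [CompleteSpace H]

/-- Without adjoints, the relation can be tested on subspaces, dense subsets and orthogonal
summands. -/
lemma adjoint_mul_eq_adjoint_iff {A B C : H →L[ℂ] H} :
    adjoint A * B = adjoint C ↔ ∀ x y, inner ℂ (B x) (A y) = inner ℂ x (C y) := by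
  constructor
  · intro h x y
    rw [← adjoint_inner_left, ← adjoint_inner_left, ← h]
    rfl
  · intro h
    ext x
    refine ext_inner_right ℂ fun y => ?_
    change inner ℂ (adjoint A (B x)) y = _
    rw [adjoint_inner_left, adjoint_inner_left, h]

lemma adjoint_mul_self_eq_one_iff {A : H →L[ℂ] H} :
    adjoint A * A = 1 ↔ ∀ x y, inner ℂ (A x) (A y) = inner ℂ x y := by
  have h : adjoint (1 : H →L[ℂ] H) = 1 := adjoint_id
  conv_lhs => rw [← h]
  exact adjoint_mul_eq_adjoint_iff

lemma norm_polyEval_apply_le {m : ℕ} {S : Fin (m + 1) → H →L[ℂ] H} (hS : IsometryCriterion S)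
    (p : MvPolynomial (Fin m) ℂ) (x : H) :
    ‖polyEval (fun j : Fin m => (((m : ℂ) - ((j : ℕ) : ℂ)) / ((m : ℂ) + 1)) • S j.castSucc) p x‖ ≤
      supNormGamma p * ‖x‖ :=
  le_of_opNorm_le _ (hS.2.2.2 p) x

/-- The criterion passes to restrictions. -/
lemma IsometryCriterion.of_intertwine {K : Type*} [NormedAddCommGroup K] [InnerProductSpace ℂ K]
    [CompleteSpace K] {m : ℕ} {T : Fin (m + 1) → K →L[ℂ] K} (hT : IsometryCriterion T)
    {S : Fin (m + 1) → H →L[ℂ] H} (V : H →ₗᵢ[ℂ] K) (h : ∀ i x, T i (V x) = V (S i x)) :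
    IsometryCriterion S := by
  refine ⟨?_, fun j => ?_, fun i j => ?_, fun p => ?_⟩
  · rw [adjoint_mul_self_eq_one_iff]
    intro x y
    rw [← V.inner_map_map, ← h, ← h, adjoint_mul_self_eq_one_iff.1 hT.1, V.inner_map_map]
  · rw [adjoint_mul_eq_adjoint_iff]
    intro x y
    rw [← V.inner_map_map, ← h, ← h, adjoint_mul_eq_adjoint_iff.1 (hT.2.1 j), h, V.inner_map_map]
  · ext x
    apply V.injective
    have := congrArg (fun F : K →L[ℂ] K => F (V x)) (hT.2.2.1 i j).eq
    simpa [h] using this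
  · refine opNorm_le_bound _ (supNormGamma_nonneg p) fun x => ?_
    rw [← V.norm_map, ← V.norm_map x]
    have := polyEval_apply_of_intertwine (T := fun j : Fin m =>
      (((m : ℂ) - ((j : ℕ) : ℂ)) / ((m : ℂ) + 1)) • T j.castSucc) (S := fun j : Fin m =>
      (((m : ℂ) - ((j : ℕ) : ℂ)) / ((m : ℂ) + 1)) • S j.castSucc) V.toLinearMap
      (fun i x => by simp [h]) p x
    change ‖V.toLinearMap _‖ ≤ _
    rw [← this]
    exact norm_polyEval_apply_le hT p _

theorem IsGammaIsometry.isometryCriterion {m : ℕ} {S : Fin (m + 1) → H →L[ℂ] H}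
    (hS : IsGammaIsometry S) : IsometryCriterion S := by
  obtain ⟨K, _, _, _, V, T, hT, h⟩ := hS
  exact hT.isometryCriterion.of_intertwine V h

/-- All `S i` commute with the isometry `S (Fin.last m)`, so they extend to the space of its unitary
extension. The criterion holds on each copy of `H` and hence, by density, everywhere; there the last
operator is surjective. -/
theorem IsometryCriterion.isGammaIsometry {m : ℕ} {S : Fin (m + 1) → H →L[ℂ] H}
    (hS : IsometryCriterion S) (hcomm : ∀ i j, Commute (S i) (S j)) : IsGammaIsometry S := by
  let W : H →ₗᵢ[ℂ] H := (S (Fin.last m)).toLinearMap.isometryOfInner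
    (adjoint_mul_self_eq_one_iff.1 hS.1)
  have hWS : ∀ x, W x = S (Fin.last m) x := fun x => rfl
  obtain ⟨K, _, _, _, V, hV, hdense, hlift⟩ := exists_unitaryExtension W
  have hSW : ∀ i x, S i (W x) = W (S i x) := fun i x =>
    congrArg (fun F : H →L[ℂ] H => F x) (hcomm i (Fin.last m)).eq
  choose T hT using fun i => hlift (S i) (hSW i)
  have hVpow : ∀ k r x, V (k + r) ((W ^ r) x) = V k x := by
    intro k r
    induction r with
    | zero => intro x; rfl
    | succ r ih =>
      intro x
      rw [← ih x, pow_succ', ← add_assoc]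
      exact hV _ _
  have hext : ∀ {A B : K →L[ℂ] K}, (∀ k x, A (V k x) = B (V k x)) → A = B := by
    intro A B h
    refine DFunLike.coe_injective (Continuous.ext_on hdense A.continuous B.continuous ?_)
    rintro _ hx
    obtain ⟨k, x, rfl⟩ := Set.mem_iUnion.1 hx
    exact h k x
  have hTcomm : ∀ i j, Commute (T i) (T j) := fun i j => hext fun k x => by
    have := congrArg (fun F : H →L[ℂ] H => V k (F x)) (hcomm i j).eq
    simpa [hT] using this
  have hinner : ∀ {A B C D : K →L[ℂ] K}, (∀ k x y, inner ℂ (A (V k x)) (B (V k y)) =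
      inner ℂ (C (V k x)) (D (V k y))) → ∀ x y, inner ℂ (A x) (B y) = inner ℂ (C x) (D y) := by
    intro A B C D h x y
    have hcont : ∀ x, (fun y => inner ℂ (A x) (B y)) = fun y => inner ℂ (C x) (D y) := by
      intro x
      refine Continuous.ext_on hdense (by fun_prop) (by fun_prop) ?_
      rintro _ hy
      obtain ⟨l, y, rfl⟩ := Set.mem_iUnion.1 hy
      refine congrFun (Continuous.ext_on hdense (f := fun x => inner ℂ (A x) (B (V l y)))
        (g := fun x => inner ℂ (C x) (D (V l y))) (by fun_prop) (by fun_prop) ?_) x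
      rintro _ hx
      obtain ⟨k, x, rfl⟩ := Set.mem_iUnion.1 hx
      -- Two vectors from stages `k` and `l` are compared in the common stage `k + l`.
      rw [← hVpow k l x, ← hVpow l k y, add_comm l k]
      exact h _ _ _
    exact congrFun (hcont x) y
  have hcrit : IsometryCriterion T := by
    refine ⟨?_, fun j => ?_, fun i j => ((hTcomm _ _).smul_left _).smul_right _, fun p => ?_⟩
    · rw [adjoint_mul_self_eq_one_iff]
      refine hinner (C := 1) (D := 1) fun k x y => ?_
      rw [hT, hT, (V k).inner_map_map, adjoint_mul_self_eq_one_iff.1 hS.1]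
      exact ((V k).inner_map_map x y).symm
    · rw [adjoint_mul_eq_adjoint_iff]
      refine hinner (C := 1) fun k x y => ?_
      rw [hT, hT, hT, (V k).inner_map_map, adjoint_mul_eq_adjoint_iff.1 (hS.2.1 j)]
      exact ((V k).inner_map_map _ _).symm
    · refine opNorm_le_bound _ (supNormGamma_nonneg p) fun x => ?_
      refine hdense.induction (P := fun x => ‖polyEval (fun j : Fin m =>
        (((m : ℂ) - ((j : ℕ) : ℂ)) / ((m : ℂ) + 1)) • T j.castSucc) p x‖ ≤
          supNormGamma p * ‖x‖) ?_ (isClosed_le (by fun_prop) (by fun_prop)) x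
      intro y hy
      obtain ⟨k, y, rfl⟩ := Set.mem_iUnion.1 hy
      have := polyEval_apply_of_intertwine (T := fun j : Fin m =>
        (((m : ℂ) - ((j : ℕ) : ℂ)) / ((m : ℂ) + 1)) • T j.castSucc) (S := fun j : Fin m =>
        (((m : ℂ) - ((j : ℕ) : ℂ)) / ((m : ℂ) + 1)) • S j.castSucc) (V k).toLinearMap
        (fun i x => by simp [hT]) p y
      change ‖polyEval _ p ((V k).toLinearMap y)‖ ≤ _
      rw [this]
      change ‖V k _‖ ≤ _
      rw [(V k).norm_map, (V k).norm_map]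
      exact norm_polyEval_apply_le hS p y
  refine ⟨K, _, _, ‹_›, V 0, T, hcrit.isGammaUnitary hTcomm ?_, fun i x => hT i 0 x⟩
  have hclosed : IsClosed (Set.range (T (Fin.last m))) :=
    (((T (Fin.last m)).toLinearMap.isometryOfInner
      (adjoint_mul_self_eq_one_iff.1 hcrit.1)).isometry.isClosedEmbedding).isClosed_range
  -- The extension of `W` shifts stages, so a vector of stage `k` is the image of the same vector in
  -- stage `k + 1`. The range is thus dense, and it is closed because the operator is isometric.
  have hsub : (⋃ k, Set.range (V k)) ⊆ Set.range (T (Fin.last m)) := by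
    refine Set.iUnion_subset fun k => ?_
    rintro _ ⟨x, rfl⟩
    exact ⟨V (k + 1) x, by rw [hT, ← hWS, hV]⟩
  rw [← Set.range_eq_univ, ← Set.univ_subset_iff, ← hdense.closure_eq]
  exact closure_minimal hsub hclosed

end Criterion

end SymmetrizedDisc

/-! ### Wold decomposition and orthogonal sums. -/

namespace SymmetrizedDisc

open ContinuousLinearMap InnerProductSpace

section Wold

variable {H : Type u} [NormedAddCommGroup H] [InnerProductSpace ℂ H]

/-- The intersection of the ranges of the powers of an operator. -/
noncomputable def residualSubspace (W : H →L[ℂ] H) : Submodule ℂ H :=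
  ⨅ k : ℕ, LinearMap.range (W ^ k : H →L[ℂ] H).toLinearMap

lemma mem_residualSubspace {W : H →L[ℂ] H} {x : H} :
    x ∈ residualSubspace W ↔ ∀ k : ℕ, ∃ y, (W ^ k) y = x := by
  rw [residualSubspace, Submodule.mem_iInf]
  rfl

lemma apply_mem_residualSubspace {W A : H →L[ℂ] H} (h : Commute A W) {x : H}
    (hx : x ∈ residualSubspace W) : A x ∈ residualSubspace W := by
  rw [mem_residualSubspace] at hx ⊢
  intro k
  obtain ⟨y, rfl⟩ := hx k
  exact ⟨A y, (congrArg (fun F : H →L[ℂ] H => F y) (h.pow_right k).eq).symm⟩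

lemma coe_restrictTuple_pow {n : ℕ} (S : Fin n → H →L[ℂ] H) (M : Submodule ℂ H)
    (hM : ∀ i, ∀ x ∈ M, S i x ∈ M) (i : Fin n) (k : ℕ) (x : M) :
    (((restrictTuple S M hM i ^ k) x : M) : H) = (S i ^ k) x := by
  induction k with
  | zero => rfl
  | succ k ih =>
    rw [pow_succ', pow_succ']
    change S i ((restrictTuple S M hM i ^ k) x : M) = S i ((S i ^ k) x)
    rw [ih]

lemma commute_restrictTuple {n : ℕ} {S : Fin n → H →L[ℂ] H} (hcomm : ∀ i j, Commute (S i) (S j))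
    (M : Submodule ℂ H) (hM : ∀ i, ∀ x ∈ M, S i x ∈ M) (i j : Fin n) :
    Commute (restrictTuple S M hM i) (restrictTuple S M hM j) := by
  ext x
  exact congrArg (fun F : H →L[ℂ] H => F x) (hcomm i j).eq

lemma IsGammaIsometry.restrictTuple {n : ℕ} {S : Fin n → H →L[ℂ] H} (hS : IsGammaIsometry S)
    (M : Submodule ℂ H) (hM : ∀ i, ∀ x ∈ M, S i x ∈ M) :
    IsGammaIsometry (restrictTuple S M hM) := by
  obtain ⟨K, _, _, _, V, T, hT, h⟩ := hS
  exact ⟨K, _, _, ‹_›, V.comp M.subtypeₗᵢ, T, hT, fun i x => h i x⟩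

lemma IsGammaUnitary.isGammaIsometry [CompleteSpace H] {n : ℕ} {S : Fin n → H →L[ℂ] H}
    (hS : IsGammaUnitary S) : IsGammaIsometry S :=
  ⟨H, _, _, ‹_›, .id, S, hS, fun _ _ => rfl⟩

variable [CompleteSpace H]

lemma IsReducing.orthogonal {T : H →L[ℂ] H} {M : Submodule ℂ H} (h : IsReducing T M) :
    IsReducing T Mᗮ := by
  refine ⟨fun x hx => ?_, fun x hx => ?_⟩ <;> rw [Submodule.mem_orthogonal] at hx ⊢ <;> intro y hy
  · rw [← adjoint_inner_left]
    exact hx _ (h.2 y hy)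
  · rw [adjoint_inner_right]
    exact hx _ (h.1 y hy)

lemma isClosed_residualSubspace {W : H →L[ℂ] H} (hW : ∀ x, ‖W x‖ = ‖x‖) :
    IsClosed (residualSubspace W : Set H) := by
  rw [residualSubspace, Submodule.coe_iInf]
  refine isClosed_iInter fun k => ?_
  have hk : Isometry (W ^ k : H →L[ℂ] H) := by
    refine AddMonoidHomClass.isometry_of_norm _ fun x => ?_
    induction k with
    | zero => rfl
    | succ k ih =>
      rw [pow_succ']
      exact (hW _).trans ih
  exact hk.isClosedEmbedding.isClosed_range

variable {m : ℕ} {S : Fin (m + 1) → H →L[ℂ] H}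

lemma IsometryCriterion.norm_last (hS : IsometryCriterion S) (x : H) :
    ‖S (Fin.last m) x‖ = ‖x‖ :=
  ((S (Fin.last m)).toLinearMap.isometryOfInner (adjoint_mul_self_eq_one_iff.1 hS.1)).norm_map x

lemma IsometryCriterion.adjoint_last_apply (hS : IsometryCriterion S) (x : H) :
    adjoint (S (Fin.last m)) (S (Fin.last m) x) = x :=
  congrArg (fun F : H →L[ℂ] H => F x) hS.1

/-- The adjoint of the last operator removes one power from `(S (Fin.last m)) ^ (k + 1)`. Every
other adjoint is this one composed with an entry of the tuple, and the entries preserve the subspace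
by commutation. -/
lemma IsometryCriterion.isReducing_residualSubspace (hS : IsometryCriterion S)
    (hcomm : ∀ i j, Commute (S i) (S j)) (i : Fin (m + 1)) :
    IsReducing (S i) (residualSubspace (S (Fin.last m))) := by
  have hinv : ∀ i, ∀ x ∈ residualSubspace (S (Fin.last m)),
      S i x ∈ residualSubspace (S (Fin.last m)) :=
    fun i x hx => apply_mem_residualSubspace (hcomm i _) hx
  have hadj : ∀ x ∈ residualSubspace (S (Fin.last m)),
      adjoint (S (Fin.last m)) x ∈ residualSubspace (S (Fin.last m)) := by
    intro x hx
    rw [mem_residualSubspace] at hx ⊢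
    intro k
    obtain ⟨y, rfl⟩ := hx (k + 1)
    refine ⟨y, ?_⟩
    rw [pow_succ']
    exact (hS.adjoint_last_apply _).symm
  refine ⟨hinv i, fun x hx => ?_⟩
  refine Fin.lastCases (hadj x hx) (fun j => ?_) i
  have h := hS.2.1 j.rev
  rw [Fin.rev_rev] at h
  rw [← h]
  exact hadj _ (hinv _ _ hx)

/-- The Wold decomposition of a tuple that satisfies the criterion. -/
theorem IsometryCriterion.exists_wold (hS : IsometryCriterion S)
    (hcomm : ∀ i j, Commute (S i) (S j)) :
    ∃ (H₁ H₂ : Submodule ℂ H) (_ : CompleteSpace H₁) (_ : CompleteSpace H₂)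
      (h₁ : ∀ i, IsReducing (S i) H₁) (h₂ : ∀ i, IsReducing (S i) H₂),
      H₁ ⟂ H₂ ∧ H₁ ⊔ H₂ = ⊤ ∧ IsGammaUnitary (restrictTuple S H₁ fun i => (h₁ i).1) ∧
        IsPureGammaIsometry (restrictTuple S H₂ fun i => (h₂ i).1) := by
  set M := residualSubspace (S (Fin.last m))
  have hMc : CompleteSpace M := (isClosed_residualSubspace hS.norm_last).completeSpace_coe
  have hred := hS.isReducing_residualSubspace hcomm
  refine ⟨M, Mᗮ, hMc, inferInstance, hred, fun i => (hred i).orthogonal,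
    Submodule.isOrtho_orthogonal_right M, Submodule.sup_orthogonal_of_hasOrthogonalProjection,
    ?_, ?_, ?_, ?_⟩
  -- On `M` the last operator is surjective: a vector of `M` lies in its range, so it is the image
  -- of its own image under the adjoint.
  · refine (hS.of_intertwine M.subtypeₗᵢ fun i x => rfl).isGammaUnitary
      (commute_restrictTuple hcomm M _) fun x => ?_
    refine ⟨⟨adjoint (S (Fin.last m)) x, (hred _).2 x x.2⟩, Subtype.ext ?_⟩
    obtain ⟨y, hy⟩ := mem_residualSubspace.1 x.2 1
    rw [pow_one] at hy
    change S (Fin.last m) (adjoint (S (Fin.last m)) x) = x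
    rw [← hy, hS.adjoint_last_apply]
  · exact (hS.isGammaIsometry hcomm).restrictTuple _ _
  · exact AddMonoidHomClass.isometry_of_norm _ fun x => hS.norm_last x
  · refine Set.eq_singleton_iff_unique_mem.2 ⟨Set.mem_iInter.2 fun k => ⟨0, map_zero _⟩,
      fun x hx => ?_⟩
    -- A vector in all ranges of the restricted powers lies in `M` as well as in `Mᗮ`.
    have hx1 : (x : H) ∈ M := by
      refine mem_residualSubspace.2 fun k => ?_
      obtain ⟨y, hy⟩ := Set.mem_iInter.1 hx k
      exact ⟨y, by rw [← hy, coe_restrictTuple_pow]⟩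
    exact Subtype.ext (inner_self_eq_zero.1 ((Submodule.mem_orthogonal M x).1 x.2 x hx1))

lemma inner_add_add_eq_of_isOrtho {E : Type*} [NormedAddCommGroup E] [InnerProductSpace ℂ E]
    {M N : Submodule ℂ E} (h : M ⟂ N) {a c b d : E} (ha : a ∈ M) (hc : c ∈ M) (hb : b ∈ N)
    (hd : d ∈ N) : inner ℂ (a + b) (c + d) = inner ℂ a c + inner ℂ b d := by
  rw [inner_add_left, inner_add_right, inner_add_right, h.inner_eq ha hd, h.symm.inner_eq hb hc]
  ring

/-- The criterion passes to orthogonal sums. -/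
theorem isometryCriterion_of_isOrtho (hcomm : ∀ i j, Commute (S i) (S j)) {M N : Submodule ℂ H}
    [CompleteSpace M] [CompleteSpace N] (hMN : M ⟂ N) (htop : M ⊔ N = ⊤)
    (hM : ∀ i, ∀ x ∈ M, S i x ∈ M) (hN : ∀ i, ∀ x ∈ N, S i x ∈ N)
    (h₁ : IsometryCriterion (restrictTuple S M hM))
    (h₂ : IsometryCriterion (restrictTuple S N hN)) : IsometryCriterion S := by
  have hdec : ∀ x : H, ∃ a ∈ M, ∃ b ∈ N, a + b = x := fun x =>
    Submodule.mem_sup.1 (htop ▸ Submodule.mem_top)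
  refine ⟨?_, fun j => ?_, fun i j => ((hcomm _ _).smul_left _).smul_right _, fun p => ?_⟩
  · rw [adjoint_mul_self_eq_one_iff]
    intro x y
    obtain ⟨a, ha, b, hb, rfl⟩ := hdec x
    obtain ⟨c, hc, d, hd, rfl⟩ := hdec y
    rw [map_add, map_add, inner_add_add_eq_of_isOrtho hMN (hM _ a ha) (hM _ c hc) (hN _ b hb)
      (hN _ d hd), inner_add_add_eq_of_isOrtho hMN ha hc hb hd]
    exact congrArg₂ (· + ·) (adjoint_mul_self_eq_one_iff.1 h₁.1 ⟨a, ha⟩ ⟨c, hc⟩)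
      (adjoint_mul_self_eq_one_iff.1 h₂.1 ⟨b, hb⟩ ⟨d, hd⟩)
  · rw [adjoint_mul_eq_adjoint_iff]
    intro x y
    obtain ⟨a, ha, b, hb, rfl⟩ := hdec x
    obtain ⟨c, hc, d, hd, rfl⟩ := hdec y
    rw [map_add, map_add, map_add, inner_add_add_eq_of_isOrtho hMN (hM _ a ha) (hM _ c hc)
      (hN _ b hb) (hN _ d hd), inner_add_add_eq_of_isOrtho hMN ha (hM _ c hc) hb (hN _ d hd)]
    exact congrArg₂ (· + ·) (adjoint_mul_eq_adjoint_iff.1 (h₁.2.1 j) ⟨a, ha⟩ ⟨c, hc⟩)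
      (adjoint_mul_eq_adjoint_iff.1 (h₂.2.1 j) ⟨b, hb⟩ ⟨d, hd⟩)
  · set C := supNormGamma p
    set P := polyEval
      (fun j : Fin m => (((m : ℂ) - ((j : ℕ) : ℂ)) / ((m : ℂ) + 1)) • S j.castSucc) p
    have hC : 0 ≤ C := supNormGamma_nonneg p
    -- `P` acts on each summand as the same polynomial in the restricted tuple, so Pythagoras
    -- combines the two bounds without loss.
    have hpart : ∀ (L : Submodule ℂ H) [CompleteSpace L] (hL : ∀ i, ∀ x ∈ L, S i x ∈ L),
        IsometryCriterion (restrictTuple S L hL) → ∀ a ∈ L, P a ∈ L ∧ ‖P a‖ ≤ C * ‖a‖ := by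
      intro L _ hL hcrit a ha
      have h := polyEval_apply_of_intertwine (T := fun j : Fin m =>
        (((m : ℂ) - ((j : ℕ) : ℂ)) / ((m : ℂ) + 1)) • S j.castSucc) (S := fun j : Fin m =>
        (((m : ℂ) - ((j : ℕ) : ℂ)) / ((m : ℂ) + 1)) • restrictTuple S L hL j.castSucc) L.subtype
        (fun i x => rfl) p ⟨a, ha⟩
      change P a = _ at h
      rw [h]
      exact ⟨Subtype.property _, norm_polyEval_apply_le hcrit p ⟨a, ha⟩⟩
    refine opNorm_le_bound _ hC fun x => ?_
    obtain ⟨a, ha, b, hb, rfl⟩ := hdec x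
    obtain ⟨hPa, hPa'⟩ := hpart M hM h₁ a ha
    obtain ⟨hPb, hPb'⟩ := hpart N hN h₂ b hb
    refine le_of_sq_le_sq ?_ (by positivity)
    rw [map_add, mul_pow, pow_two ‖P a + P b‖, pow_two ‖a + b‖,
      norm_add_sq_eq_norm_sq_add_norm_sq_of_inner_eq_zero (𝕜 := ℂ) _ _ (hMN.inner_eq hPa hPb),
      norm_add_sq_eq_norm_sq_add_norm_sq_of_inner_eq_zero (𝕜 := ℂ) _ _ (hMN.inner_eq ha hb)]
    have e1 := mul_self_le_mul_self (norm_nonneg _) hPa'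
    have e2 := mul_self_le_mul_self (norm_nonneg _) hPb'
    linarith

end Wold

end SymmetrizedDisc


/-- The tuple `(S_1, …, S_n)` has length `n = m + 1 ≥ 1` and `S_k` is the entry of index `k - 1`.
So `S_n` is `S (Fin.last m)`, and for `j : Fin m` and `k = j + 1 ∈ {1, …, n - 1}` the operator `S_k`
is `S j.castSucc`, the operator `S_{n-k}` is `S j.rev.castSucc`, and `γ_k = (n - k) / n` is
`(m - j) / (m + 1)`. -/
theorem mainTheorem4 {H : Type u} [NormedAddCommGroup H] [InnerProductSpace ℂ H]
    [CompleteSpace H] (m : ℕ) (S : Fin (m + 1) → H →L[ℂ] H)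
    (hcomm : ∀ i j, Commute (S i) (S j)) :
    List.TFAE
      [SymmetrizedDisc.IsGammaIsometry S,
       ∃ (H₁ H₂ : Submodule ℂ H) (_ : CompleteSpace H₁) (_ : CompleteSpace H₂)
         (h₁ : ∀ i, SymmetrizedDisc.IsReducing (S i) H₁)
         (h₂ : ∀ i, SymmetrizedDisc.IsReducing (S i) H₂),
         H₁ ⟂ H₂ ∧ H₁ ⊔ H₂ = ⊤ ∧
         SymmetrizedDisc.IsGammaUnitary
           (SymmetrizedDisc.restrictTuple S H₁ fun i => (h₁ i).1) ∧
         SymmetrizedDisc.IsPureGammaIsometry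
           (SymmetrizedDisc.restrictTuple S H₂ fun i => (h₂ i).1),
       ContinuousLinearMap.adjoint (S (Fin.last m)) * S (Fin.last m) = 1 ∧
         (∀ j : Fin m, ContinuousLinearMap.adjoint (S (Fin.last m)) * S j.castSucc =
           ContinuousLinearMap.adjoint (S j.rev.castSucc)) ∧
         SymmetrizedDisc.IsGammaContraction
           (fun j : Fin m => (((m : ℂ) - ((j : ℕ) : ℂ)) / ((m : ℂ) + 1)) • S j.castSucc)] := by
  tfae_have 1 → 2 := fun h => h.isometryCriterion.exists_wold hcomm
  tfae_have 2 → 3 := by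
    rintro ⟨H₁, H₂, _, _, h₁, h₂, hortho, htop, hunitary, hpure⟩
    exact SymmetrizedDisc.isometryCriterion_of_isOrtho hcomm hortho htop (fun i => (h₁ i).1)
      (fun i => (h₂ i).1) hunitary.isometryCriterion hpure.1.isometryCriterion
  tfae_have 3 → 1 := fun h => SymmetrizedDisc.IsometryCriterion.isGammaIsometry h hcomm
  tfae_finish
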